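/- Let $1\le m\le n$. Let $\beta=\frac i2\sum_j dz_j\wedge d\bar z_j$ on $\mathbb C^n$, and let $\Gamma_m$ be the set of real $(1,1)$-forms $\alpha$ with constant coefficients such that $\alpha^k\wedge\beta^{n-k}\ge 0$ for $k=1,\dots,m$. A continuous function $w:U\to\mathbb R$ on an open set $U\subset\mathbb C^n$ is called $m$-subharmonic if it is subharmonic and $dd^cw\wedge\alpha_1\wedge\dots\wedge\alpha_{m-1}\wedge\beta^{n-m}\ge 0$ in the sense of currents for all $\alpha_1,\dots,\alpha_{m-1}\in\Gamma_m$. Let $X\subset\mathbb C^n$ be compact. For $z\in X$ let $\mathcal J^m_z(X)$ be the set of Borel probability measures $\mu$ on $X$ such that $w(z)\le\int_X w\,d\mu$ for every function $w$ that is continuous and $m$-subharmonic on some open neighbourhood of $X$. Let $\mathcal{SH}_m(X)$ be the set of upper semicontinuous functions $w:X\to[-\infty,\infty)$ such that $w(z)\le\int_X w\,d\mu$ for all $z\in X$ and all $\mu\in\mathcal J_z^m(X)$, and let $\mathcal C(X)$ be the set of continuous functions $X\to\mathbb R$. **Corollary.** Let $\omega,\Omega\subset\mathbb C^n$ be open sets,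 $\Omega$ bounded, with $\omega\Subset\Omega$ (that is, $\bar\omega$ is compact and contained in $\Omega$). Let $u\in\mathcal{SH}_m(\bar\omega)\cap\mathcal C(\bar\omega)$ and $v\in\mathcal{SH}_m(\bar\Omega)\cap\mathcal C(\bar\Omega)$ satisfy $u(z)\le v(z)$ for all $z\in\partial\omega$. Then the function $$\varphi=\begin{cases} v & \text{on } \bar\Omega\setminus\omega,\\ \max\{u,v\} & \text{on } \omega,\end{cases}$$ belongs to $\mathcal{SH}_m(\bar\Omega)\cap\mathcal C(\bar\Omega)$. -/

import Mathlib

open MeasureTheory Set Filter Topology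

noncomputable section

/-- Complex Euclidean space `ℂⁿ`. -/
abbrev Cn (n : ℕ) : Type := EuclideanSpace ℂ (Fin n)

/-- A real `(1,1)`-form with constant coefficients `α = (i/2) ∑ aⱼₖ dzⱼ ∧ dz̄ₖ` is represented by
its Hermitian coefficient matrix `A = (aⱼₖ)`; the standard Kähler form `β` is represented by the
identity matrix. For forms `α₁, …, αₙ` represented by `A₁, …, Aₙ`, the number `wedgeCoeff A` is the
coefficient of the top degree form `α₁ ∧ ⋯ ∧ αₙ` with respect to the volume form `dV = βⁿ / n!`,
that is, `n!` times the mixed discriminant of `A₁, …, Aₙ`. It is real for Hermitian matrices. -/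
def wedgeCoeff {n : ℕ} (A : Fin n → Matrix (Fin n) (Fin n) ℂ) : ℂ :=
  ∑ σ : Equiv.Perm (Fin n), (Matrix.of fun i j => A (σ j) i j).det

/-- The set of real `(1,1)`-forms `α` with constant coefficients such that
`αᵏ ∧ βⁿ⁻ᵏ ≥ 0` for `k = 1, …, m`. -/
def gardingCone (n m : ℕ) : Set (Matrix (Fin n) (Fin n) ℂ) :=
  {A | A.IsHermitian ∧
    ∀ k : ℕ, 1 ≤ k → k ≤ m → 0 ≤ (wedgeCoeff fun i : Fin n => if (i : ℕ) < k then A else 1).re}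

/-- The complex Hessian `(∂²φ / ∂zⱼ ∂z̄ₖ)` at `z` of a real-valued function `φ` on `ℂⁿ`, written
through real second derivatives, with `∂/∂zⱼ = (∂/∂xⱼ - i ∂/∂yⱼ) / 2` and
`∂/∂z̄ₖ = (∂/∂xₖ + i ∂/∂yₖ) / 2`. -/
def complexHessian {n : ℕ} (φ : Cn n → ℝ) (z : Cn n) : Matrix (Fin n) (Fin n) ℂ :=
  Matrix.of fun j k =>
    let D : Cn n → Cn n → ℝ := fun v w => fderiv ℝ (fderiv ℝ φ) z v w
    let ex : Fin n → Cn n := fun l => EuclideanSpace.single l (1 : ℂ)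
    let ey : Fin n → Cn n := fun l => EuclideanSpace.single l Complex.I
    (1 / 4 : ℂ) * (((D (ex j) (ex k) + D (ey j) (ey k) : ℝ) : ℂ) +
      Complex.I * ((D (ex j) (ey k) - D (ey j) (ex k) : ℝ) : ℂ))

/-- The coefficient, with respect to `dV` and up to a positive constant, of
`ddᶜφ ∧ α₁ ∧ ⋯ ∧ αₘ₋₁ ∧ βⁿ⁻ᵐ` at `z`. Only the entries `α 0, …, α (m - 2)` are used. -/
def hessianWedge {n : ℕ} (m : ℕ) (α : ℕ → Matrix (Fin n) (Fin n) ℂ) (φ : Cn n → ℝ) (z : Cn n) :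
    ℝ :=
  (wedgeCoeff fun i : Fin n =>
    if (i : ℕ) + 1 < m then α i else if (i : ℕ) + 1 = m then complexHessian φ z else 1).re

/-- `u` is a (real-valued) continuous `m`-subharmonic function on the open set `U ⊆ ℂⁿ`:
it is continuous and subharmonic on `U`, and
`ddᶜu ∧ α₁ ∧ ⋯ ∧ αₘ₋₁ ∧ βⁿ⁻ᵐ ≥ 0` on `U` in the sense of currents, for all real `(1,1)`-forms
`α₁, …, αₘ₋₁` with constant coefficients such that `αⱼᵏ ∧ βⁿ⁻ᵏ ≥ 0` for `k = 1, …, m`. -/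
structure IsContMSubharmonicOn {n : ℕ} (m : ℕ) (u : Cn n → ℝ) (U : Set (Cn n)) : Prop where
  continuousOn : ContinuousOn u U
  subharmonic : ∀ z ∈ U, ∀ᶠ r : ℝ in 𝓝[>] 0, u z ≤ ⨍ x in Metric.ball z r, u x
  current_nonneg : ∀ α : ℕ → Matrix (Fin n) (Fin n) ℂ, (∀ j, α j ∈ gardingCone n m) →
    ∀ φ : Cn n → ℝ, ContDiff ℝ (⊤ : ℕ∞) φ → HasCompactSupport φ → tsupport φ ⊆ U → (∀ x, 0 ≤ φ x) →
      0 ≤ ∫ x, u x * hessianWedge m α φ x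

/-- `μ` is a Jensen measure on the compact set `X` with barycenter `z`: a Borel probability measure
carried by `X` such that `u z ≤ ∫_X u dμ` for every `u` that is continuous and `m`-subharmonic on
some open neighbourhood of `X`. (Regularity is automatic for finite Borel measures on `ℂⁿ`.) -/
structure IsJensenMeasure {n : ℕ} (m : ℕ) (X : Set (Cn n)) (z : Cn n) (μ : Measure (Cn n)) :
    Prop where
  isProbabilityMeasure : IsProbabilityMeasure μ
  carried : μ Xᶜ = 0
  le_integral : ∀ (U : Set (Cn n)) (u : Cn n → ℝ), IsOpen U → X ⊆ U →
    IsContMSubharmonicOn m u U → u z ≤ ∫ x in X, u x ∂μ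

/-- The integral over `X` of an extended real-valued function `u`, as the difference of the
integrals of its positive and negative parts. It may be `-∞`; the positive part has finite integral
if `u` is bounded above on `X` and `μ` is finite. -/
def extIntegral {n : ℕ} (X : Set (Cn n)) (μ : Measure (Cn n)) (u : Cn n → EReal) : EReal :=
  ((∫⁻ x in X, (u x).toENNReal ∂μ : ENNReal) : EReal) -
    ((∫⁻ x in X, (-u x).toENNReal ∂μ : ENNReal) : EReal)

/-- `u` is `m`-subharmonic on the compact set `X ⊆ ℂⁿ`: it is upper semicontinuous on `X` with
values in `[-∞, ∞)`, and `u z ≤ ∫_X u dμ` for all `z ∈ X` and all Jensen measures `μ` on `X` with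
barycenter `z`. Only the values of `u` on `X` matter. -/
structure IsMSubharmonicOnCompact {n : ℕ} (m : ℕ) (X : Set (Cn n)) (u : Cn n → EReal) : Prop where
  upperSemicontinuousOn : UpperSemicontinuousOn u X
  lt_top : ∀ z ∈ X, u z < ⊤
  le_extIntegral : ∀ z ∈ X, ∀ μ : Measure (Cn n), IsJensenMeasure m X z μ →
    u z ≤ extIntegral X μ u

end

/-! Gluing is easy for functions `m`-subharmonic near the compact sets. If `f` near `closure ω` and
`g` near `closure Ω` satisfy `f < g` on the boundary of `ω`, then `max f g` on `ω` and `g` elsewhere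
agree near that boundary, and `m`-subharmonicity is local. Two ingredients reduce the corollary to
this case.

The first is an Edwards-type duality. For fixed `z`, the supremum of `f z` over functions `f ≤ w`
that are `m`-subharmonic near `X` is superlinear in `w`. Hahn–Banach and Riesz produce a Jensen
measure whose integral of `w` equals this supremum, so the Jensen inequality for `w` says that the
supremum is `w z`. Compactness and stability under maxima then give uniform approximation of `w`
from below (`exists_isMSubharmonicNear_approx`). Conversely, Jensen inequalities pass to uniform
limits (`le_integral_of_approx`). Lowering the approximant of `u` slightly makes the boundary
inequality strict.

The second is that continuous `m`-subharmonic functions, defined through currents, are stable under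
maxima. Gårding's theory of hyperbolic polynomials (`wedgeForm_re_pos`) shows that `H ↦ H ∧ α₁ ∧ ⋯ ∧
αₘ₋₁ ∧ βⁿ⁻ᵐ` is nonnegative on positive semidefinite `H`. The operator applied to test functions is
therefore a sum of second derivatives along fixed directions (`exists_hessianWedge_eq_sum`).
Nonnegativity of symmetric second differences survives a pointwise maximum, and mollification
carries this over to distributions (`IsDistribSubsolution.max`). -/

/-! ### The polarised wedge product: symmetry and reality -/

/-- The map `(A₁, …, Aₙ) ↦ wedgeCoeff A` as a multilinear map. -/
noncomputable def wedgeForm (n : ℕ) :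
    MultilinearMap ℂ (fun _ : Fin n => Matrix (Fin n) (Fin n) ℂ) ℂ :=
  ∑ σ : Equiv.Perm (Fin n),
    ((Matrix.detRowAlternating (R := ℂ) (n := Fin n)).toMultilinearMap.compLinearMap
      fun j => (LinearMap.proj j ∘ₗ (Matrix.transposeLinearEquiv (Fin n) (Fin n) ℂ ℂ).toLinearMap :
        Matrix (Fin n) (Fin n) ℂ →ₗ[ℂ] (Fin n → ℂ))).domDomCongr σ

theorem wedgeForm_apply {n : ℕ} (A : Fin n → Matrix (Fin n) (Fin n) ℂ) :
    wedgeForm n A = wedgeCoeff A := by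
  simp only [wedgeForm, wedgeCoeff, sum_apply, MultilinearMap.domDomCongr_apply,
    MultilinearMap.compLinearMap_apply]
  refine Finset.sum_congr rfl fun σ _ => ?_
  rw [← Matrix.det_transpose]
  rfl

theorem wedgeForm_comp_perm {n : ℕ} (A : Fin n → Matrix (Fin n) (Fin n) ℂ)
    (τ : Equiv.Perm (Fin n)) : wedgeForm n (fun i => A (τ i)) = wedgeForm n A := by
  simp only [wedgeForm_apply, wedgeCoeff]
  exact Equiv.sum_comp (Equiv.mulLeft τ)
    fun σ : Equiv.Perm (Fin n) => (Matrix.of fun i j => A (σ j) i j).det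

theorem wedgeForm_const {n : ℕ} (A : Matrix (Fin n) (Fin n) ℂ) :
    wedgeForm n (fun _ => A) = (n.factorial : ℂ) * A.det := by
  simp only [wedgeForm_apply, wedgeCoeff]
  rw [Finset.sum_const, Finset.card_univ, Fintype.card_perm, Fintype.card_fin, nsmul_eq_mul]
  rfl

/-- Conjugation transposes each Hermitian matrix. In the double sum over permutations this is undone
by the substitutions `π ↦ π⁻¹` and `σ ↦ σ π⁻¹`. -/
theorem wedgeForm_im {n : ℕ} (A : Fin n → Matrix (Fin n) (Fin n) ℂ)
    (hA : ∀ i, (A i).IsHermitian) : (wedgeForm n A).im = 0 := by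
  rw [← Complex.conj_eq_iff_im, wedgeForm_apply, wedgeCoeff, map_sum]
  simp only [Matrix.det_apply, map_sum, Matrix.of_apply]
  rw [Finset.sum_comm, Finset.sum_comm (s := Finset.univ) (t := Finset.univ)
    (f := fun σ π : Equiv.Perm (Fin n) => Equiv.Perm.sign π • ∏ i, A (σ i) (π i) i)]
  rw [← Equiv.sum_comp (Equiv.inv (Equiv.Perm (Fin n)))]
  refine Finset.sum_congr rfl fun π _ => ?_
  rw [← Equiv.sum_comp (Equiv.mulRight π⁻¹)]
  refine Finset.sum_congr rfl fun σ _ => ?_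
  simp only [Equiv.inv_apply, Equiv.coe_mulRight, Equiv.Perm.sign_inv, Units.smul_def, zsmul_eq_mul,
    map_mul, map_prod, map_intCast]
  congr 1
  rw [← Equiv.prod_comp π]
  refine Finset.prod_congr rfl fun i _ => ?_
  simp only [Equiv.Perm.mul_apply, Equiv.Perm.coe_inv, Equiv.symm_apply_apply]
  exact (hA _).apply _ _

/-! ### The wedge product as a polynomial along a line of matrices -/

/-- The value of the wedge product with `Z` in the slots in `S` and `R` in the other slots. -/
noncomputable def slotForm {n : ℕ} (S : Finset (Fin n)) (R : Fin n → Matrix (Fin n) (Fin n) ℂ)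
    (Z : Matrix (Fin n) (Fin n) ℂ) : ℂ :=
  wedgeForm n (S.piecewise (fun _ => Z) R)

theorem slotForm_smul {n : ℕ} (S : Finset (Fin n)) (R : Fin n → Matrix (Fin n) (Fin n) ℂ)
    (c : ℂ) (Z : Matrix (Fin n) (Fin n) ℂ) :
    slotForm S R (c • Z) = c ^ S.card * slotForm S R Z := by
  have h := (wedgeForm n).map_piecewise_smul (fun _ => c) (S.piecewise (fun _ => Z) R) S
  rw [Finset.prod_const, smul_eq_mul] at h
  rw [slotForm, slotForm, ← h]
  congr 1
  ext i : 1
  by_cases hi : i ∈ S <;> simp [hi]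

theorem slotForm_add_smul {n : ℕ} (S : Finset (Fin n)) (R : Fin n → Matrix (Fin n) (Fin n) ℂ)
    (Z B : Matrix (Fin n) (Fin n) ℂ) (s : ℂ) :
    slotForm S R (Z + s • B) = ∑ T ∈ S.powerset,
      s ^ T.card * wedgeForm n (T.piecewise (fun _ => B) (S.piecewise (fun _ => Z) R)) := by
  have h := (wedgeForm n).map_piecewise_add (fun _ => s • B) (S.piecewise (fun _ => Z) R) S
  have h1 : S.piecewise ((fun _ => s • B) + S.piecewise (fun _ => Z) R)
      (S.piecewise (fun _ => Z) R) = S.piecewise (fun _ => Z + s • B) R := by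
    ext i : 1
    by_cases hi : i ∈ S <;> simp [hi, add_comm]
  rw [h1] at h
  rw [slotForm, h]
  refine Finset.sum_congr rfl fun T _ => ?_
  exact slotForm_smul T _ s B

/-- The polynomial `s ↦ slotForm S R (Z + s B)`. -/
noncomputable def slotPoly {n : ℕ} (S : Finset (Fin n)) (R : Fin n → Matrix (Fin n) (Fin n) ℂ)
    (Z B : Matrix (Fin n) (Fin n) ℂ) : Polynomial ℂ :=
  ∑ T ∈ S.powerset, Polynomial.C
    (wedgeForm n (T.piecewise (fun _ => B) (S.piecewise (fun _ => Z) R))) * Polynomial.X ^ T.card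

section slotPoly

variable {n : ℕ} (S : Finset (Fin n)) (R : Fin n → Matrix (Fin n) (Fin n) ℂ)
  (Z B : Matrix (Fin n) (Fin n) ℂ)

theorem eval_slotPoly (s : ℂ) : (slotPoly S R Z B).eval s = slotForm S R (Z + s • B) := by
  rw [slotForm_add_smul, slotPoly, Polynomial.eval_finsetSum]
  refine Finset.sum_congr rfl fun T _ => ?_
  rw [Polynomial.eval_mul, Polynomial.eval_C, Polynomial.eval_pow, Polynomial.eval_X, mul_comm]

theorem coeff_slotPoly (k : ℕ) : (slotPoly S R Z B).coeff k = ∑ T ∈ S.powersetCard k,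
    wedgeForm n (T.piecewise (fun _ => B) (S.piecewise (fun _ => Z) R)) := by
  rw [slotPoly, Polynomial.finsetSum_coeff, Finset.powersetCard_eq_filter, Finset.sum_filter]
  refine Finset.sum_congr rfl fun T _ => ?_
  rw [Polynomial.coeff_C_mul_X_pow]
  rcases eq_or_ne T.card k with h | h
  · simp [h]
  · simp [h, h.symm]

theorem natDegree_slotPoly_le : (slotPoly S R Z B).natDegree ≤ S.card := by
  rw [Polynomial.natDegree_le_iff_coeff_eq_zero]
  intro k hk
  rw [coeff_slotPoly, Finset.powersetCard_eq_empty.2 hk, Finset.sum_empty]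

theorem coeff_slotPoly_card : (slotPoly S R Z B).coeff S.card = slotForm S R B := by
  rw [coeff_slotPoly, Finset.powersetCard_self, Finset.sum_singleton, slotForm]
  congr 1
  ext i : 1
  by_cases hi : i ∈ S <;> simp [hi]

/-- By symmetry every slot of `S` contributes equally. Differentiation along `B` at `0` thus fixes
`B` in one slot, which is how polarisation is reached from derivatives. -/
theorem coeff_slotPoly_one {i : Fin n} (hi : i ∈ S) :
    (slotPoly S R Z B).coeff 1 = S.card *
      wedgeForm n (Function.update (S.piecewise (fun _ => Z) R) i B) := by
  rw [coeff_slotPoly, Finset.powersetCard_one, Finset.sum_map, ← nsmul_eq_mul]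
  refine Finset.sum_eq_card_nsmul fun k hk => ?_
  rw [← wedgeForm_comp_perm _ (Equiv.swap i k)]
  congr 1
  ext j : 1
  simp only [Function.Embedding.coeFn_mk]
  rw [Finset.piecewise_singleton]
  rcases eq_or_ne j i with rfl | hji
  · simp
  · rcases eq_or_ne j k with rfl | hjk
    · rw [Equiv.swap_apply_right, Function.update_of_ne hji, Function.update_of_ne hji.symm]
      simp [hi, hk]
    · rw [Equiv.swap_apply_of_ne_of_ne hji hjk, Function.update_of_ne hji, Function.update_of_ne hjk]

variable {S R B} in
theorem degree_slotPoly (h : slotForm S R B ≠ 0) :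
    (slotPoly S R Z B).natDegree = S.card ∧ (slotPoly S R Z B).leadingCoeff = slotForm S R B := by
  have h1 : (slotPoly S R Z B).natDegree = S.card :=
    Polynomial.natDegree_eq_of_le_of_coeff_ne_zero (natDegree_slotPoly_le S R Z B)
      (by rwa [coeff_slotPoly_card])
  exact ⟨h1, by rw [Polynomial.leadingCoeff, h1, coeff_slotPoly_card]⟩

end slotPoly

/-! ### Gauss–Lucas and stability on tube domains -/

/-- A complex polynomial with all roots in the open lower half plane is bounded below. -/
theorem Polynomial.norm_eval_ge_of_roots_im_neg (P : Polynomial ℂ)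
    (hP : ∀ s : ℂ, 0 ≤ s.im → P.eval s ≠ 0) {s : ℂ} (hs : 0 ≤ s.im) :
    ‖P.leadingCoeff‖ * s.im ^ P.natDegree ≤ ‖P.eval s‖ := by
  have hsp := IsAlgClosed.splits P
  rw [hsp.eval_eq_prod_roots, norm_mul, hsp.natDegree_eq_card_roots]
  refine mul_le_mul_of_nonneg_left ?_ (norm_nonneg _)
  have hroot : ∀ r ∈ P.roots, s.im ≤ ‖s - r‖ := by
    intro r hr
    have h0 : r.im < 0 := by
      by_contra! h
      exact hP r h (Polynomial.isRoot_of_mem_roots hr)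
    refine le_trans ?_ (Complex.abs_im_le_norm _)
    rw [Complex.sub_im]
    exact le_trans (by linarith) (le_abs_self _)
  generalize P.roots = M at hroot
  induction M using Multiset.induction_on with
  | empty => simp
  | cons a M ih =>
    simp only [Multiset.card_cons, Multiset.map_cons, Multiset.prod_cons, norm_mul, pow_succ']
    exact mul_le_mul (hroot a (by simp)) (ih fun r hr => hroot r (by simp [hr])) (by positivity)
      (by positivity)

/-- If all roots lie in the open lower half plane, then so do those of the derivative. -/
theorem Polynomial.eval_derivative_ne_zero_of_roots_im_neg (P : Polynomial ℂ)
    (hP : ∀ s : ℂ, 0 ≤ s.im → P.eval s ≠ 0) (hd : 0 < P.natDegree) {s : ℂ} (hs : 0 ≤ s.im) :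
    P.derivative.eval s ≠ 0 := by
  intro h0
  have hd' : P.derivative ≠ 0 := by
    intro h
    exact hd.ne' (Polynomial.derivative_eq_zero.1 h)
  -- Gauss–Lucas: critical points lie in the convex hull of the roots, and the open lower half plane
  -- is convex.
  have hmem := Polynomial.rootSet_derivative_subset_convexHull_rootSet
    (Polynomial.natDegree_pos_iff_degree_pos.1 hd)
    (show s ∈ P.derivative.rootSet ℂ by
      rw [Polynomial.mem_rootSet]; exact ⟨hd', by simpa using h0⟩)
  have hconv : Convex ℝ {z : ℂ | z.im < 0} := convex_halfSpace_im_lt 0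
  have hsub : P.rootSet ℂ ⊆ {z : ℂ | z.im < 0} := by
    intro z hz
    by_contra h
    exact hP z (not_lt.1 h) (by simpa using (Polynomial.mem_rootSet.1 hz).2)
  have := convexHull_min hsub hconv hmem
  exact absurd this (not_lt.2 hs)

/-- A set of Hermitian matrices which is stable under `(Y, B) ↦ Y + t B`, `t ≥ 0`. -/
structure IsHermitianCone {n : ℕ} (C : Set (Matrix (Fin n) (Fin n) ℂ)) : Prop where
  isHermitian : ∀ Y ∈ C, Y.IsHermitian
  add_smul_mem : ∀ Y ∈ C, ∀ B ∈ C, ∀ t : ℝ, 0 ≤ t → Y + (t : ℂ) • B ∈ C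

/-- The form `slotForm S R` does not vanish on the tube domain over `C`. -/
def IsTubeStable {n : ℕ} (C : Set (Matrix (Fin n) (Fin n) ℂ)) (S : Finset (Fin n))
    (R : Fin n → Matrix (Fin n) (Fin n) ℂ) : Prop :=
  ∀ X : Matrix (Fin n) (Fin n) ℂ, X.IsHermitian → ∀ Y ∈ C,
    slotForm S R (X + Complex.I • Y) ≠ 0

theorem Matrix.IsHermitian.ofReal_smul {n : ℕ} {X : Matrix (Fin n) (Fin n) ℂ}
    (hX : X.IsHermitian) (t : ℝ) : ((t : ℂ) • X).IsHermitian := by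
  unfold Matrix.IsHermitian
  rw [Matrix.conjTranspose_smul, hX.eq]
  simp

namespace IsTubeStable

variable {n : ℕ} {C : Set (Matrix (Fin n) (Fin n) ℂ)} {S T : Finset (Fin n)}
  {R : Fin n → Matrix (Fin n) (Fin n) ℂ}

theorem slotForm_ne_zero (h : IsTubeStable C S R) {Y : Matrix (Fin n) (Fin n) ℂ} (hY : Y ∈ C) :
    slotForm S R Y ≠ 0 := by
  have h1 := h 0 Matrix.isHermitian_zero Y hY
  rw [zero_add, slotForm_smul] at h1
  exact right_ne_zero_of_mul h1

/-- For `Im s ≥ 0` the matrix `Z + s B` stays in the tube, so the polynomial in `s` has all its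
roots in the open lower half plane. By Gauss–Lucas its derivative does not vanish at `0`, and this
derivative is a nonzero multiple of the form with `B` frozen in slot `i`. -/
theorem of_insert (hC : IsHermitianCone C) {i : Fin n} (hi : i ∉ S)
    (h : IsTubeStable C (insert i S) R) {B : Matrix (Fin n) (Fin n) ℂ} (hB : B ∈ C) :
    IsTubeStable C S (Function.update R i B) := by
  intro X hX Y hY h0
  set Z := X + Complex.I • Y
  set P := slotPoly (insert i S) R Z B
  have hdeg := degree_slotPoly Z (h.slotForm_ne_zero hB)
  have hcard : (insert i S).card = S.card + 1 := Finset.card_insert_of_notMem hi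
  have hP : ∀ s : ℂ, 0 ≤ s.im → P.eval s ≠ 0 := by
    intro s hs
    rw [eval_slotPoly]
    have : Z + s • B = (X + (s.re : ℂ) • B) + Complex.I • (Y + (s.im : ℂ) • B) := by
      conv_lhs => rw [← Complex.re_add_im s]
      simp only [Z, smul_add, add_smul, smul_smul, mul_comm]
      abel
    rw [this]
    exact h _ (hX.add ((hC.isHermitian B hB).ofReal_smul _)) _ (hC.add_smul_mem Y hY B hB _ hs)
  refine P.eval_derivative_ne_zero_of_roots_im_neg hP (by rw [hdeg.1, hcard]; omega)
    (s := 0) (by simp) ?_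
  rw [← Polynomial.coeff_zero_eq_eval_zero, Polynomial.coeff_derivative]
  simp only [Nat.cast_zero, zero_add, mul_one]
  rw [coeff_slotPoly_one _ _ _ _ (Finset.mem_insert_self i S)]
  rw [slotForm] at h0
  have : Function.update ((insert i S).piecewise (fun _ => Z) R) i B =
      S.piecewise (fun _ => Z) (Function.update R i B) := by
    ext j : 1
    rcases eq_or_ne j i with rfl | hji
    · simp [hi]
    · by_cases hj : j ∈ S <;> simp [hji, hj]
  rw [this, h0, mul_zero]

theorem of_union (hC : IsHermitianCone C) (hST : Disjoint S T) (h : IsTubeStable C (S ∪ T) R)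
    {B : Fin n → Matrix (Fin n) (Fin n) ℂ} (hB : ∀ i ∈ T, B i ∈ C) :
    IsTubeStable C S (T.piecewise B R) := by
  induction T using Finset.induction_on generalizing R with
  | empty => simpa using h
  | insert i T hi ih =>
    rw [Finset.disjoint_insert_right] at hST
    rw [Finset.union_insert] at h
    have h1 := h.of_insert hC (by simp [hi, hST.1]) (hB i (by simp))
    have h2 := ih hST.2 h1 fun j hj => hB j (by simp [hj])
    convert h2 using 1
    ext j : 1
    rcases eq_or_ne j i with rfl | hji
    · simp [hi]
    · by_cases hj : j ∈ T <;> simp [hji, hj]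

end IsTubeStable

/-! ### Stability over positive definite matrices -/

section PosDef

open scoped ComplexOrder

/-- A kernel vector `v` would give `v* X v + i v* Y v = 0`, whose imaginary part is `v* Y v > 0`. -/
theorem Matrix.PosDef.det_add_I_smul_ne_zero {n : ℕ} {X Y : Matrix (Fin n) (Fin n) ℂ}
    (hX : X.IsHermitian) (hY : Y.PosDef) : (X + Complex.I • Y).det ≠ 0 := by
  intro h
  obtain ⟨v, hv, hv0⟩ := Matrix.exists_mulVec_eq_zero_iff.2 h
  have h1 : star v ⬝ᵥ X.mulVec v + Complex.I * (star v ⬝ᵥ Y.mulVec v) = 0 := by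
    have := congrArg (fun w => star v ⬝ᵥ w) hv0
    simpa [Matrix.add_mulVec, Matrix.smul_mulVec, dotProduct_add] using this
  have h2 := (Matrix.posDef_iff_dotProduct_mulVec.1 hY).2 hv
  have hXr := hX.im_star_dotProduct_mulVec_self v
  have h3 := congrArg Complex.im h1
  rw [Complex.lt_def] at h2
  simp only [RCLike.im_to_complex] at hXr
  simp [hXr] at h3
  exact h2.1.ne' h3

theorem isHermitianCone_posDef (n : ℕ) :
    IsHermitianCone {Y : Matrix (Fin n) (Fin n) ℂ | Y.PosDef} where
  isHermitian _ hY := hY.isHermitian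
  add_smul_mem Y hY B hB t ht :=
    Matrix.PosDef.add_posSemidef hY (hB.posSemidef.smul (by exact_mod_cast ht))

/-- The form `Z ↦ Zᵐ ∧ Iⁿ⁻ᵐ` does not vanish on the tube over the positive definite cone. -/
theorem isTubeStable_posDef {n : ℕ} (S : Finset (Fin n)) :
    IsTubeStable {Y : Matrix (Fin n) (Fin n) ℂ | Y.PosDef} S 1 := by
  have h : IsTubeStable {Y : Matrix (Fin n) (Fin n) ℂ | Y.PosDef} (S ∪ Sᶜ) 1 := by
    intro X hX Y hY
    rw [Finset.union_compl, slotForm, Finset.piecewise_univ, wedgeForm_const]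
    exact mul_ne_zero (by exact_mod_cast n.factorial_ne_zero)
      (Matrix.PosDef.det_add_I_smul_ne_zero hX hY)
  have := h.of_union (isHermitianCone_posDef n) disjoint_compl_right (B := 1)
    fun i _ => Matrix.PosDef.one
  rwa [Finset.piecewise_same] at this

end PosDef

theorem continuous_wedgeForm (n : ℕ) : Continuous (wedgeForm n) := by
  have : (wedgeForm n : (Fin n → Matrix (Fin n) (Fin n) ℂ) → ℂ) = fun A => wedgeCoeff A :=
    funext wedgeForm_apply
  rw [this]
  unfold wedgeCoeff
  refine continuous_finsetSum _ fun σ _ => Continuous.matrix_det ?_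
  refine continuous_matrix fun i j => ?_
  simp only [Matrix.of_apply]
  fun_prop

/-! ### Continuity of roots -/

section slotForm

variable {n : ℕ} {S : Finset (Fin n)} {R : Fin n → Matrix (Fin n) (Fin n) ℂ}

theorem continuous_slotForm : Continuous (slotForm S R) := by
  refine (continuous_wedgeForm n).comp (continuous_pi fun i => ?_)
  by_cases hi : i ∈ S <;> simp only [Finset.piecewise, hi, if_true, if_false] <;> fun_prop

/-- The lower bound does not involve `Z`, so it survives limits in `Z` and turns nonvanishing into a
closed condition. -/
theorem norm_slotForm_ge {Z B : Matrix (Fin n) (Fin n) ℂ} (hB : slotForm S R B ≠ 0)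
    (h : ∀ s : ℂ, 0 ≤ s.im → slotForm S R (Z + s • B) ≠ 0) {s : ℂ} (hs : 0 ≤ s.im) :
    ‖slotForm S R B‖ * s.im ^ S.card ≤ ‖slotForm S R (Z + s • B)‖ := by
  have hd := degree_slotPoly Z hB
  have := (slotPoly S R Z B).norm_eval_ge_of_roots_im_neg
    (fun s hs => by rw [eval_slotPoly]; exact h s hs) hs
  rwa [hd.1, hd.2, eval_slotPoly] at this

/-- Continuity of roots: if no root of `s ↦ slotForm S R (Z τ + s B)` crosses the real axis, the
roots remain in the lower half plane. -/
theorem slotForm_ne_zero_of_homotopy {Z : ℝ → Matrix (Fin n) (Fin n) ℂ} (hZ : Continuous Z)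
    {B : Matrix (Fin n) (Fin n) ℂ} (hB : slotForm S R B ≠ 0)
    (hreal : ∀ τ ∈ Icc (0 : ℝ) 1, ∀ s : ℝ, slotForm S R (Z τ + (s : ℂ) • B) ≠ 0)
    (h0 : ∀ s : ℂ, 0 ≤ s.im → slotForm S R (Z 0 + s • B) ≠ 0) {s : ℂ} (hs : 0 ≤ s.im) :
    slotForm S R (Z 1 + s • B) ≠ 0 := by
  set A : Set unitInterval := {τ | ∀ s : ℂ, 0 ≤ s.im → slotForm S R (Z τ + s • B) ≠ 0}
  have hq : Continuous (slotForm S R) := continuous_slotForm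
  -- For `Im s > 0`, nonvanishing is replaced by the closed uniform lower bound; real `s` is covered
  -- by `hreal`.
  have hclosed : IsClosed A := by
    have : A = ⋂ s : ℂ, ⋂ _ : 0 ≤ s.im, {τ : unitInterval |
        ‖slotForm S R B‖ * s.im ^ S.card ≤ ‖slotForm S R (Z τ + s • B)‖} := by
      ext τ
      simp only [mem_iInter, mem_ofPred_eq, A]
      refine ⟨fun h s hs => norm_slotForm_ge hB h hs, fun h s hs => ?_⟩
      rcases hs.eq_or_lt with hs0 | hs0
      · have := hreal τ τ.2 s.re
        rwa [show ((s.re : ℝ) : ℂ) = s from Complex.ext rfl (by simpa using hs0)] at this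
      · rw [← norm_pos_iff]
        exact lt_of_lt_of_le (mul_pos (norm_pos_iff.2 hB) (pow_pos hs0 _)) (h s hs)
    rw [this]
    refine isClosed_iInter fun s => isClosed_iInter fun _ => isClosed_le (by fun_prop) ?_
    exact (hq.comp (by fun_prop)).norm
  have hopen : IsOpen A := by
    rw [← isClosed_compl_iff]
    -- Roots are homogenised to pairs `(a, b)` with `a + ‖b‖ = 1`, so that none can escape to
    -- infinity: a limit with `a = 0` would force `slotForm S R B = 0`. Hence `Aᶜ` is the projection
    -- of a compact set.
    set K : Set (unitInterval × ℝ × ℂ) := (univ ×ˢ Icc 0 1 ×ˢ Metric.closedBall 0 1) ∩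
      {p | 0 ≤ p.2.2.im ∧ p.2.1 + ‖p.2.2‖ = 1 ∧
        slotForm S R ((p.2.1 : ℂ) • Z p.1 + p.2.2 • B) = 0}
    have hK : IsCompact K := by
      refine (isCompact_univ.prod (isCompact_Icc.prod
        (isCompact_closedBall (0 : ℂ) 1))).inter_right ?_
      refine IsClosed.and (isClosed_le (by fun_prop)
        (Complex.continuous_im.comp (continuous_snd.comp continuous_snd)))
        (IsClosed.and (isClosed_eq (by fun_prop) (by fun_prop))
          (isClosed_eq (hq.comp ?_) continuous_const))
      have : Continuous fun p : unitInterval × ℝ × ℂ => ((p.2.1 : ℝ) : ℂ) :=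
        Complex.continuous_ofReal.comp (by fun_prop)
      fun_prop
    have himg : Aᶜ = Prod.fst '' K := by
      ext τ
      simp only [mem_compl_iff, mem_ofPred_eq, A, not_forall, not_not, mem_image, Prod.exists,
        exists_and_right, exists_eq_right]
      constructor
      · rintro ⟨s, hs, h⟩
        have hp : 0 < 1 + ‖s‖ := by positivity
        have hn : ‖s / ((1 + ‖s‖ : ℝ) : ℂ)‖ = ‖s‖ / (1 + ‖s‖) := by
          rw [norm_div, Complex.norm_real, Real.norm_of_nonneg hp.le]
        refine ⟨1 / (1 + ‖s‖), s / ((1 + ‖s‖ : ℝ) : ℂ), ⟨⟨mem_univ _, ⟨by positivity, ?_⟩, ?_⟩,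
          ?_, ?_, ?_⟩⟩
        · simp only
          rw [div_le_one hp]
          linarith [norm_nonneg s]
        · rw [mem_closedBall_zero_iff]
          simp only
          rw [hn, div_le_one hp]
          linarith
        · simp only
          rw [Complex.div_ofReal_im]
          positivity
        · simp only
          rw [hn]
          field_simp
        · have : ((1 / (1 + ‖s‖) : ℝ) : ℂ) • Z τ + (s / ((1 + ‖s‖ : ℝ) : ℂ)) • B =
              ((1 / (1 + ‖s‖) : ℝ) : ℂ) • (Z τ + s • B) := by
            rw [smul_add, smul_smul]
            congr 2
            push_cast
            ring
          simp only
          rw [this, slotForm_smul, h, mul_zero]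
      · rintro ⟨a, b, ⟨-, ha, -⟩, hb, hab, h⟩
        simp only at ha hb hab h
        rcases ha.1.eq_or_lt with rfl | ha0
        · rw [Complex.ofReal_zero, zero_smul, zero_add, slotForm_smul] at h
          have hb0 : b ≠ 0 := by rintro rfl; simp at hab
          exact absurd h (mul_ne_zero (pow_ne_zero _ hb0) hB)
        · refine ⟨b / (a : ℂ), by rw [Complex.div_ofReal_im]; positivity, ?_⟩
          have ha1 : (a : ℂ) ≠ 0 := by exact_mod_cast ha0.ne'
          have : (a : ℂ) • Z τ + b • B = (a : ℂ) • (Z τ + (b / (a : ℂ)) • B) := by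
            rw [smul_add, smul_smul, mul_div_cancel₀ _ ha1]
          rw [this, slotForm_smul] at h
          exact (mul_eq_zero.1 h).resolve_left (pow_ne_zero _ ha1)
    rw [himg]
    exact (hK.image continuous_fst).isClosed
  have huniv : A = univ := IsClopen.eq_univ ⟨hclosed, hopen⟩ ⟨0, by simpa [A] using h0⟩
  have h1 : (1 : unitInterval) ∈ A := huniv ▸ mem_univ _
  simpa using h1 s hs

end slotForm

/-! ### The hyperbolicity cone and Gårding's inequality -/

section nonvanishingCone

open scoped ComplexOrder

/-- The Hermitian matrices `Y` such that the form `Z ↦ slotForm S 1 Z` does not vanish on the ray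
`Y + t I`, `t ≥ 0`. -/
def nonvanishingCone {n : ℕ} (S : Finset (Fin n)) : Set (Matrix (Fin n) (Fin n) ℂ) :=
  {Y | Y.IsHermitian ∧ ∀ t : ℝ, 0 ≤ t → slotForm S 1 (Y + (t : ℂ) • 1) ≠ 0}

variable {n : ℕ} {S : Finset (Fin n)} {X Y A : Matrix (Fin n) (Fin n) ℂ}

theorem posDef_ofReal_smul_one {t : ℝ} (ht : 0 < t) :
    ((t : ℂ) • (1 : Matrix (Fin n) (Fin n) ℂ)).PosDef :=
  Matrix.PosDef.one.smul (by exact_mod_cast ht)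

theorem mem_nonvanishingCone_of_posDef (hY : Y.PosDef) : Y ∈ nonvanishingCone S :=
  ⟨hY.isHermitian, fun _ ht => (isTubeStable_posDef S).slotForm_ne_zero
    (hY.add_posSemidef (Matrix.PosSemidef.one.smul (by exact_mod_cast ht)))⟩

theorem slotForm_ne_zero_of_mem (hY : Y ∈ nonvanishingCone S) : slotForm S 1 Y ≠ 0 := by
  simpa using hY.2 0 le_rfl

theorem smul_mem_nonvanishingCone (hY : Y ∈ nonvanishingCone S) {c : ℝ} (hc : 0 < c) :
    (c : ℂ) • Y ∈ nonvanishingCone S := by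
  refine ⟨hY.1.ofReal_smul c, fun t ht => ?_⟩
  have hc' : (c : ℂ) ≠ 0 := by exact_mod_cast hc.ne'
  have : (c : ℂ) • Y + (t : ℂ) • (1 : Matrix (Fin n) (Fin n) ℂ) =
      (c : ℂ) • (Y + ((t / c : ℝ) : ℂ) • 1) := by
    rw [smul_add, smul_smul]
    congr 2
    push_cast
    field_simp
  rw [this, slotForm_smul]
  exact mul_ne_zero (pow_ne_zero _ hc') (hY.2 _ (by positivity))

theorem add_smul_one_mem_nonvanishingCone (hY : Y ∈ nonvanishingCone S) {c : ℝ} (hc : 0 ≤ c) :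
    Y + (c : ℂ) • 1 ∈ nonvanishingCone S := by
  refine ⟨hY.1.add (Matrix.isHermitian_one.ofReal_smul c), fun t ht => ?_⟩
  have := hY.2 (c + t) (by positivity)
  rwa [Complex.ofReal_add, add_smul, ← add_assoc] at this

theorem segment_mem_nonvanishingCone (hY : Y ∈ nonvanishingCone S) {τ : ℝ} (hτ : τ ∈ Icc (0 : ℝ) 1) :
    ((1 - τ : ℝ) : ℂ) • 1 + (τ : ℂ) • Y ∈ nonvanishingCone S := by
  rcases hτ.1.eq_or_lt with rfl | h0
  · simpa using mem_nonvanishingCone_of_posDef (Matrix.PosDef.one (n := Fin n) (R := ℂ))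
  · have := add_smul_one_mem_nonvanishingCone (smul_mem_nonvanishingCone hY h0)
      (sub_nonneg.2 hτ.2)
    rwa [add_comm] at this

/-- For `s ≠ 0`, factor out `s` to get `Y + w I` with `w = iε / s`. If `w` is not real, positive
definite stability applies, after a change of sign when `Im w < 0`. If `w` is real, then `w = ε Im s
/ |s|² ≥ 0` and the definition of the cone applies. -/
theorem slotForm_I_smul_one_add_ne_zero (hY : Y ∈ nonvanishingCone S) {ε : ℝ} (hε : 0 < ε) {s : ℂ}
    (hs : 0 ≤ s.im) : slotForm S 1 (Complex.I • (ε : ℂ) • 1 + s • Y) ≠ 0 := by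
  rcases eq_or_ne s 0 with rfl | hs0
  · have := isTubeStable_posDef S 0 Matrix.isHermitian_zero _ (posDef_ofReal_smul_one hε)
    simpa using this
  set w : ℂ := Complex.I * ε / s with hw
  have h1 : Complex.I • (ε : ℂ) • (1 : Matrix (Fin n) (Fin n) ℂ) + s • Y = s • (Y + w • 1) := by
    rw [smul_add, smul_smul, smul_smul, add_comm]
    congr 2
    rw [hw]
    field_simp
  rw [h1, slotForm_smul]
  refine mul_ne_zero (pow_ne_zero _ hs0) ?_
  have hre : ∀ r : ℝ, (Y + (r : ℂ) • (1 : Matrix (Fin n) (Fin n) ℂ)).IsHermitian := fun r =>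
    hY.1.add (Matrix.isHermitian_one.ofReal_smul r)
  have h2 : Y + w • 1 = (Y + (w.re : ℂ) • 1) + Complex.I • (w.im : ℂ) • 1 := by
    conv_lhs => rw [← Complex.re_add_im w]
    rw [add_smul, smul_smul, mul_comm, add_assoc]
  rcases lt_trichotomy w.im 0 with h | h | h
  · have h3 : Y + w • 1 =
        (-1 : ℂ) • (-(Y + (w.re : ℂ) • 1) + Complex.I • ((-w.im : ℝ) : ℂ) • 1) := by
      rw [h2]
      simp only [Complex.ofReal_neg, neg_smul, smul_neg, one_smul, neg_add, neg_neg]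
    rw [h3, slotForm_smul]
    exact mul_ne_zero (pow_ne_zero _ (by norm_num))
      (isTubeStable_posDef S _ (hre _).neg _ (posDef_ofReal_smul_one (neg_pos.2 h)))
  · rw [h2, h, Complex.ofReal_zero, zero_smul, smul_zero, add_zero]
    refine hY.2 _ ?_
    rw [hw, Complex.div_re]
    simp only [Complex.mul_re, Complex.I_re, Complex.ofReal_re, Complex.I_im, Complex.ofReal_im,
      Complex.mul_im]
    have := Complex.normSq_nonneg s
    ring_nf
    positivity
  · rw [h2]
    exact isTubeStable_posDef S _ (hre _) _ (posDef_ofReal_smul_one h)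

/-- Along `τ X + iε I + s Y` no root `s` is real, by stability over positive definite matrices, so
the roots stay in the lower half plane from `τ = 0` to `τ = 1`. The bound at `s = i` is uniform in
`ε`, which permits `ε → 0`. -/
theorem isTubeStable_nonvanishingCone (S : Finset (Fin n)) :
    IsTubeStable (nonvanishingCone S) S 1 := by
  intro X hX Y hY
  have hq : Continuous (slotForm S (1 : Fin n → Matrix (Fin n) (Fin n) ℂ)) := continuous_slotForm
  have hYq := slotForm_ne_zero_of_mem hY
  have hne : ∀ ε : ℝ, 0 < ε → ∀ s : ℂ, 0 ≤ s.im →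
      slotForm S 1 (X + Complex.I • (ε : ℂ) • 1 + s • Y) ≠ 0 := by
    intro ε hε s hs
    have := slotForm_ne_zero_of_homotopy (S := S) (R := 1) (B := Y)
      (Z := fun τ : ℝ => (τ : ℂ) • X + Complex.I • (ε : ℂ) • 1) (by fun_prop) hYq
      (fun τ _ r => ?_) (fun s hs => ?_) hs
    · simpa using this
    · have := isTubeStable_posDef S ((τ : ℂ) • X + (r : ℂ) • Y)
        ((hX.ofReal_smul τ).add (hY.1.ofReal_smul r)) _ (posDef_ofReal_smul_one hε)
      rwa [add_right_comm] at this
    · simpa using slotForm_I_smul_one_add_ne_zero hY hε hs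
  have hge : ∀ ε : ℝ, 0 < ε → ‖slotForm S 1 Y‖ ≤
      ‖slotForm S 1 (X + Complex.I • (ε : ℂ) • 1 + Complex.I • Y)‖ := by
    intro ε hε
    simpa using norm_slotForm_ge hYq (hne ε hε) (s := Complex.I) (by simp)
  have hlim : Tendsto (fun ε : ℝ =>
      ‖slotForm S 1 (X + Complex.I • (ε : ℂ) • 1 + Complex.I • Y)‖) (𝓝[>] 0)
      (𝓝 ‖slotForm S 1 (X + Complex.I • Y)‖) := by
    have hc : Continuous fun ε : ℝ =>
        ‖slotForm S 1 (X + Complex.I • (ε : ℂ) • 1 + Complex.I • Y)‖ :=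
      (hq.comp (by fun_prop)).norm
    have := hc.tendsto 0
    simp only [Complex.ofReal_zero, zero_smul, smul_zero, add_zero] at this
    exact this.mono_left nhdsWithin_le_nhds
  have := ge_of_tendsto hlim (eventually_nhdsWithin_of_forall hge)
  exact norm_pos_iff.1 (lt_of_lt_of_le (norm_pos_iff.2 hYq) this)

/-- Apply continuity of roots to `i((1 - τ) I + τ Y) + s B`: real roots are excluded by tube
stability over the segment from `I` to `Y`. At `τ = 1`, `s = it`, the matrix is `i (Y + t B)`, and
the power of `i` factors out. -/
theorem isHermitianCone_nonvanishingCone (S : Finset (Fin n)) :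
    IsHermitianCone (nonvanishingCone S) where
  isHermitian Y hY := hY.1
  add_smul_mem := by
    have key : ∀ Y ∈ nonvanishingCone S, ∀ B ∈ nonvanishingCone S, ∀ t : ℝ, 0 ≤ t →
        slotForm S 1 (Y + (t : ℂ) • B) ≠ 0 := by
      intro Y hY B hB t ht
      have := slotForm_ne_zero_of_homotopy (S := S) (R := 1) (B := B)
        (Z := fun τ : ℝ => Complex.I • (((1 - τ : ℝ) : ℂ) • 1 + (τ : ℂ) • Y)) (by fun_prop)
        (slotForm_ne_zero_of_mem hB) (fun τ hτ r => ?_) (fun s hs => ?_)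
        (s := Complex.I * t) (by simpa using ht)
      · rw [mul_smul, ← smul_add, slotForm_smul] at this
        simpa using right_ne_zero_of_mul this
      · rw [add_comm]
        exact isTubeStable_nonvanishingCone S _ (hB.1.ofReal_smul r) _
          (segment_mem_nonvanishingCone hY hτ)
      · simpa using slotForm_I_smul_one_add_ne_zero hB one_pos hs
    intro Y hY B hB t ht
    refine ⟨hY.1.add (hB.1.ofReal_smul t), fun r hr => ?_⟩
    rw [add_right_comm]
    exact key _ (add_smul_one_mem_nonvanishingCone hY hr) B hB t ht

/-- **Gårding's inequality** for the polarised form. -/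
theorem wedgeForm_re_pos {B : Fin n → Matrix (Fin n) (Fin n) ℂ}
    (hB : ∀ i ∈ S, B i ∈ nonvanishingCone S) : 0 < (wedgeForm n (S.piecewise B 1)).re := by
  set F : ℝ → Fin n → Matrix (Fin n) (Fin n) ℂ := fun τ =>
    S.piecewise (fun i => ((1 - τ : ℝ) : ℂ) • 1 + (τ : ℂ) • B i) 1
  have hFc : Continuous F := by
    refine continuous_pi fun i => ?_
    by_cases hi : i ∈ S <;> simp only [F, Finset.piecewise, hi, if_true, if_false] <;> fun_prop
  -- Freezing every slot of `S` by polarisation leaves a nonzero number, real because the matrices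
  -- are Hermitian. Its sign is thus constant along the path from the identity, where the value is
  -- `n!`.
  have hne : ∀ τ ∈ Icc (0 : ℝ) 1, (wedgeForm n (F τ)).re ≠ 0 := by
    intro τ hτ h
    have hst : IsTubeStable (nonvanishingCone S) ∅ (F τ) :=
      IsTubeStable.of_union (isHermitianCone_nonvanishingCone S) (Finset.disjoint_empty_left S)
        (by rw [Finset.empty_union]; exact isTubeStable_nonvanishingCone S)
        fun i hi => segment_mem_nonvanishingCone (hB i hi) hτ
    have h1 := hst 0 Matrix.isHermitian_zero 1
      (mem_nonvanishingCone_of_posDef Matrix.PosDef.one)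
    rw [slotForm, Finset.piecewise_empty] at h1
    refine h1 (Complex.ext h (wedgeForm_im _ fun i => ?_))
    by_cases hi : i ∈ S
    · simpa [F, hi] using (segment_mem_nonvanishingCone (hB i hi) hτ).1
    · simp [F, hi]
  have h0 : 0 < (wedgeForm n (F 0)).re := by
    have : F 0 = fun _ => 1 := by
      ext i : 1
      by_cases hi : i ∈ S <;> simp [F, hi]
    rw [this, wedgeForm_const]
    simpa using Nat.factorial_pos n
  have h1 : F 1 = S.piecewise B 1 := by
    ext i : 1
    by_cases hi : i ∈ S <;> simp [F, hi]
  rw [← h1]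
  by_contra! hneg
  have hcont : ContinuousOn (fun τ => (wedgeForm n (F τ)).re) (Icc 0 1) :=
    (Complex.continuous_re.comp ((continuous_wedgeForm n).comp hFc)).continuousOn
  obtain ⟨τ, hτ, h⟩ := intermediate_value_Icc' zero_le_one hcont ⟨hneg, h0.le⟩
  exact hne τ hτ h

end nonvanishingCone

/-! ### From the cone of the forms `α` to the hyperbolicity cone -/

theorem Finset.exists_perm_mem_iff_lt_card {n : ℕ} (U : Finset (Fin n)) :
    ∃ τ : Equiv.Perm (Fin n), ∀ i, τ i ∈ U ↔ (i : ℕ) < U.card := by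
  have hcard : Fintype.card {i : Fin n // (i : ℕ) < U.card} = Fintype.card {i // i ∈ U} := by
    rw [Fintype.card_subtype, Fin.card_filter_val_lt, Fintype.card_coe]
    exact min_eq_right (by simpa using U.card_le_univ)
  let e := Fintype.equivOfCardEq hcard
  refine ⟨e.extendSubtype, fun i => ⟨fun h => ?_, fun h => e.extendSubtype_mem i h⟩⟩
  by_contra hi
  exact e.extendSubtype_not_mem i hi h

theorem slotForm_one_eq_wedgeCoeff {n : ℕ} (U : Finset (Fin n)) (A : Matrix (Fin n) (Fin n) ℂ) :
    slotForm U 1 A = wedgeCoeff fun i : Fin n => if (i : ℕ) < U.card then A else 1 := by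
  obtain ⟨τ, hτ⟩ := U.exists_perm_mem_iff_lt_card
  rw [slotForm, ← wedgeForm_comp_perm _ τ, wedgeForm_apply]
  congr 1
  ext i : 1
  simp only [Finset.piecewise, hτ, Pi.one_apply]

theorem wedgeForm_one_re_pos (n : ℕ) :
    0 < (wedgeForm n (1 : Fin n → Matrix (Fin n) (Fin n) ℂ)).re := by
  have : wedgeForm n (1 : Fin n → Matrix (Fin n) (Fin n) ℂ) = _ := wedgeForm_const 1
  rw [this]
  simpa using Nat.factorial_pos n

theorem slotForm_re_nonneg_of_mem_gardingCone {n m : ℕ} {A : Matrix (Fin n) (Fin n) ℂ}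
    (hA : A ∈ gardingCone n m) {U : Finset (Fin n)} (hU : U.card ≤ m) :
    0 ≤ (slotForm U 1 A).re := by
  rcases Nat.eq_zero_or_pos U.card with h0 | h0
  · rw [Finset.card_eq_zero] at h0
    rw [h0, slotForm, Finset.piecewise_empty]
    exact (wedgeForm_one_re_pos n).le
  · rw [slotForm_one_eq_wedgeCoeff]
    exact hA.2 _ h0 hU

/-- In the expansion of `A + (ε + t) I` every term has nonnegative real part by the defining
inequalities of the cone, and the term with `I` in all slots is strictly positive. -/
theorem add_smul_one_mem_nonvanishingCone_of_mem_gardingCone {n m : ℕ}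
    {A : Matrix (Fin n) (Fin n) ℂ} (hA : A ∈ gardingCone n m) {S : Finset (Fin n)}
    (hS : S.card ≤ m) {ε : ℝ} (hε : 0 < ε) : A + (ε : ℂ) • 1 ∈ nonvanishingCone S := by
  refine ⟨hA.1.add (Matrix.isHermitian_one.ofReal_smul ε), fun t ht h0 => ?_⟩
  rw [add_assoc, ← add_smul, ← Complex.ofReal_add, slotForm_add_smul] at h0
  have h1 := congrArg Complex.re h0
  rw [Complex.re_sum, Complex.zero_re] at h1
  refine h1.not_gt (Finset.sum_pos' (fun T _ => ?_) ⟨S, Finset.mem_powerset_self S, ?_⟩)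
  · rw [← Complex.ofReal_pow, Complex.re_ofReal_mul]
    refine mul_nonneg (by positivity) ?_
    have h2 : T.piecewise (fun _ => (1 : Matrix (Fin n) (Fin n) ℂ)) (S.piecewise (fun _ => A) 1) =
        (S \ T).piecewise (fun _ => A) 1 := by
      ext i : 1
      by_cases hi : i ∈ T <;> by_cases hj : i ∈ S <;> simp [hi, hj]
    rw [h2]
    exact slotForm_re_nonneg_of_mem_gardingCone hA
      ((Finset.card_le_card Finset.sdiff_subset).trans hS)
  · rw [← Complex.ofReal_pow, Complex.re_ofReal_mul]
    refine mul_pos (by positivity) ?_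
    have h2 : S.piecewise (fun _ => (1 : Matrix (Fin n) (Fin n) ℂ)) (S.piecewise (fun _ => A) 1) =
        1 := by
      ext i : 1
      by_cases hj : i ∈ S <;> simp [hj]
    rw [h2]
    exact wedgeForm_one_re_pos n

/-! ### Positivity of the Hessian operator and its decomposition into squares -/

section hessianForm

open scoped ComplexOrder

variable {n m : ℕ}

/-- The linear form `H ↦ H ∧ α₁ ∧ ⋯ ∧ αₘ₋₁ ∧ Iⁿ⁻ᵐ`. -/
noncomputable def hessianForm (α : ℕ → Matrix (Fin n) (Fin n) ℂ) (hm : 1 ≤ m) (hmn : m ≤ n) :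
    Matrix (Fin n) (Fin n) ℂ →ₗ[ℂ] ℂ :=
  (wedgeForm n).toLinearMap (fun i : Fin n => if (i : ℕ) + 1 < m then α i else 1)
    ⟨m - 1, by omega⟩

theorem hessianForm_apply (α : ℕ → Matrix (Fin n) (Fin n) ℂ) (hm : 1 ≤ m) (hmn : m ≤ n)
    (H : Matrix (Fin n) (Fin n) ℂ) : hessianForm α hm hmn H = wedgeForm n fun i : Fin n =>
      if (i : ℕ) + 1 < m then α i else if (i : ℕ) + 1 = m then H else 1 := by
  rw [hessianForm, MultilinearMap.toLinearMap_apply]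
  congr 1
  ext i : 1
  rcases eq_or_ne i ⟨m - 1, by omega⟩ with rfl | hi
  · rw [Function.update_self, if_neg (by simp; omega), if_pos (by simp; omega)]
  · rw [Function.update_of_ne hi]
    have : (i : ℕ) + 1 ≠ m := fun h => hi (Fin.ext (by simp; omega))
    simp [this]

theorem hessianForm_im (α : ℕ → Matrix (Fin n) (Fin n) ℂ) (hm : 1 ≤ m) (hmn : m ≤ n)
    (hα : ∀ j, (α j).IsHermitian) {H : Matrix (Fin n) (Fin n) ℂ} (hH : H.IsHermitian) :
    (hessianForm α hm hmn H).im = 0 := by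
  rw [hessianForm_apply]
  refine wedgeForm_im _ fun i => ?_
  split_ifs
  exacts [hα _, hH, Matrix.isHermitian_one]

/-- Adding `ε I` in each of the first `m` slots moves all entries into the open cone, where
Gårding's inequality applies; then `ε → 0`. -/
theorem hessianForm_re_nonneg {α : ℕ → Matrix (Fin n) (Fin n) ℂ} (hm : 1 ≤ m) (hmn : m ≤ n)
    (hα : ∀ j, α j ∈ gardingCone n m) {H : Matrix (Fin n) (Fin n) ℂ} (hH : H.PosSemidef) :
    0 ≤ (hessianForm α hm hmn H).re := by
  set S : Finset (Fin n) := Finset.univ.filter fun i => (i : ℕ) < m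
  have hS : S.card ≤ m := by
    rw [Fin.card_filter_val_lt]
    exact min_le_right _ _
  set F : ℝ → Fin n → Matrix (Fin n) (Fin n) ℂ := fun ε =>
    S.piecewise (fun i => (if (i : ℕ) + 1 < m then α i else H) + (ε : ℂ) • 1) 1
  have hFc : Continuous F := by
    refine continuous_pi fun i => ?_
    by_cases hi : i ∈ S <;> simp only [F, Finset.piecewise, hi, if_true, if_false] <;> fun_prop
  have hpos : ∀ ε : ℝ, 0 < ε → 0 ≤ (wedgeForm n (F ε)).re := by
    intro ε hε
    refine (wedgeForm_re_pos fun i _ => ?_).le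
    split_ifs
    · exact add_smul_one_mem_nonvanishingCone_of_mem_gardingCone (hα _) hS hε
    · exact mem_nonvanishingCone_of_posDef (Matrix.PosDef.posSemidef_add hH
        (posDef_ofReal_smul_one hε))
  have h0 : F 0 = fun i : Fin n =>
      if (i : ℕ) + 1 < m then α i else if (i : ℕ) + 1 = m then H else 1 := by
    ext i : 1
    simp only [F, Finset.piecewise, S, Finset.mem_filter, Finset.mem_univ, true_and,
      Complex.ofReal_zero, zero_smul, add_zero, Pi.one_apply]
    split_ifs <;> first | rfl | omega
  rw [hessianForm_apply, ← h0]
  have hlim : Tendsto (fun ε => (wedgeForm n (F ε)).re) (𝓝[>] 0) (𝓝 (wedgeForm n (F 0)).re) :=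
    ((Complex.continuous_re.comp ((continuous_wedgeForm n).comp hFc)).tendsto 0).mono_left
      nhdsWithin_le_nhds
  exact ge_of_tendsto hlim (eventually_nhdsWithin_of_forall hpos)

/-- The coefficient matrix of the form is Hermitian because the form is real on Hermitian matrices,
and positive semidefinite because the form is nonnegative on rank one matrices `x x*`. It is
therefore a sum of rank one matrices. -/
theorem exists_hessianForm_eq_sum {α : ℕ → Matrix (Fin n) (Fin n) ℂ} (hm : 1 ≤ m) (hmn : m ≤ n)
    (hα : ∀ j, α j ∈ gardingCone n m) : ∃ (N : ℕ) (c : Fin N → Fin n → ℂ), ∀ H,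
      hessianForm α hm hmn H = ∑ l, ∑ j, ∑ k, c l j * star (c l k) * H j k := by
  set T := hessianForm α hm hmn
  have hαH : ∀ j, (α j).IsHermitian := fun j => (hα j).1
  set t : Matrix (Fin n) (Fin n) ℂ := Matrix.of fun j k => T (Matrix.single j k 1)
  have hT : ∀ H, T H = ∑ j, ∑ k, t j k * H j k := by
    intro H
    conv_lhs => rw [Matrix.matrix_eq_sum_single H]
    simp only [map_sum]
    refine Finset.sum_congr rfl fun j _ => Finset.sum_congr rfl fun k _ => ?_
    have : Matrix.single j k (H j k) = H j k • Matrix.single j k (1 : ℂ) := by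
      rw [Matrix.smul_single, smul_eq_mul, mul_one]
    rw [this, map_smul, smul_eq_mul, mul_comm]
    rfl
  have hherm : t.IsHermitian := by
    ext j k
    rw [Matrix.conjTranspose_apply]
    have h1 := hessianForm_im α hm hmn hαH
      (H := Matrix.single j k 1 + Matrix.single k j 1) (by
        unfold Matrix.IsHermitian
        rw [Matrix.conjTranspose_add, Matrix.conjTranspose_single, Matrix.conjTranspose_single,
          star_one, add_comm])
    have h2 := hessianForm_im α hm hmn hαH
      (H := Complex.I • (Matrix.single j k 1 - Matrix.single k j 1)) (by
        unfold Matrix.IsHermitian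
        rw [Matrix.conjTranspose_smul, Matrix.conjTranspose_sub, Matrix.conjTranspose_single,
          Matrix.conjTranspose_single, star_one, Complex.star_def, Complex.conj_I, neg_smul,
          ← smul_neg, neg_sub])
    rw [map_add, Complex.add_im] at h1
    rw [map_smul, map_sub, smul_eq_mul, Complex.mul_im] at h2
    simp only [Complex.I_re, Complex.I_im, Complex.sub_re, zero_mul, one_mul, zero_add] at h2
    refine Complex.ext ?_ ?_
    · simp only [Complex.star_def, Complex.conj_re, t, Matrix.of_apply, T]; linarith
    · simp only [Complex.star_def, Complex.conj_im, t, Matrix.of_apply, T]; linarith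
  have hpsd : t.PosSemidef := by
    refine Matrix.PosSemidef.of_dotProduct_mulVec_nonneg hherm fun x => ?_
    have h1 : star x ⬝ᵥ t.mulVec x = T (Matrix.vecMulVec (star x) (star (star x))) := by
      rw [hT, star_star]
      simp only [dotProduct, Matrix.mulVec, Finset.mul_sum, Matrix.vecMulVec_apply]
      refine Finset.sum_congr rfl fun j _ => Finset.sum_congr rfl fun k _ => ?_
      ring
    have h2 := Matrix.posSemidef_vecMulVec_self_star (R := ℂ) (star x)
    rw [h1, Complex.le_def]
    exact ⟨hessianForm_re_nonneg hm hmn hα h2, (hessianForm_im α hm hmn hαH h2.isHermitian).symm⟩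
  obtain ⟨N, v, hv⟩ := Matrix.posSemidef_iff_eq_sum_vecMulVec.1 hpsd
  refine ⟨N, v, fun H => ?_⟩
  rw [hT, hv]
  simp only [Matrix.sum_apply, Matrix.vecMulVec_apply, Finset.sum_mul, Pi.star_apply]
  rw [Finset.sum_comm (s := Finset.univ) (t := Finset.univ (α := Fin n))
    (f := fun l j => ∑ k, v l j * star (v l k) * H j k)]
  exact Finset.sum_congr rfl fun j _ => Finset.sum_comm

end hessianForm

/-- The sesquilinear form attached to a real bilinear form. -/
noncomputable def leviForm {E : Type*} [NormedAddCommGroup E] [NormedSpace ℂ E]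
    (D : E →L[ℝ] E →L[ℝ] ℝ) : E →ₗ[ℂ] E →ₗ⋆[ℂ] ℂ :=
  LinearMap.mk₂'ₛₗ (RingHom.id ℂ) (starRingEnd ℂ)
    (fun v w => (1 / 4 : ℂ) * (((D v w + D (Complex.I • v) (Complex.I • w) : ℝ) : ℂ) +
      Complex.I * ((D v (Complex.I • w) - D (Complex.I • v) w : ℝ) : ℂ)))
    (by intros; simp; ring)
    (by
      intro c v w
      have h1 : c • v = c.re • v + c.im • Complex.I • v := by
        conv_lhs => rw [← Complex.re_add_im c, add_smul, mul_smul]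
        simp
      have h2 : Complex.I • c • v = c.re • Complex.I • v - c.im • v := by
        rw [h1, smul_add, smul_comm, smul_comm Complex.I c.im, smul_smul, Complex.I_mul_I]
        simp [sub_eq_add_neg]
      rw [h2, h1]
      apply Complex.ext <;> simp <;> ring)
    (by intros; simp; ring)
    (by
      intro c v w
      have h1 : c • w = c.re • w + c.im • Complex.I • w := by
        conv_lhs => rw [← Complex.re_add_im c, add_smul, mul_smul]
        simp
      have h2 : Complex.I • c • w = c.re • Complex.I • w - c.im • w := by
        rw [h1, smul_add, smul_comm, smul_comm Complex.I c.im, smul_smul, Complex.I_mul_I]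
        simp [sub_eq_add_neg]
      rw [h2, h1]
      apply Complex.ext <;> simp <;> ring)

theorem leviForm_apply {E : Type*} [NormedAddCommGroup E] [NormedSpace ℂ E]
    (D : E →L[ℝ] E →L[ℝ] ℝ) (v w : E) : leviForm D v w =
      (1 / 4 : ℂ) * (((D v w + D (Complex.I • v) (Complex.I • w) : ℝ) : ℂ) +
      Complex.I * ((D v (Complex.I • w) - D (Complex.I • v) w : ℝ) : ℂ)) := rfl

theorem complexHessian_eq_leviForm {n : ℕ} (φ : Cn n → ℝ) (z : Cn n) (j k : Fin n) :
    complexHessian φ z j k = leviForm (fderiv ℝ (fderiv ℝ φ) z)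
      (EuclideanSpace.single j 1) (EuclideanSpace.single k 1) := by
  have h : ∀ l : Fin n, Complex.I • (EuclideanSpace.single l 1 : Cn n) =
      EuclideanSpace.single l Complex.I := by
    intro l
    ext i
    simp
  rw [leviForm_apply, h, h]
  rfl

theorem leviForm_self_re {E : Type*} [NormedAddCommGroup E] [NormedSpace ℂ E]
    (D : E →L[ℝ] E →L[ℝ] ℝ) (v : E) :
    (leviForm D v v).re = (1 / 4) * (D v v + D (Complex.I • v) (Complex.I • v)) := by
  rw [leviForm_apply]
  have : (1 / 4 : ℂ) = ((1 / 4 : ℝ) : ℂ) := by norm_num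
  rw [this, Complex.re_ofReal_mul]
  simp

/-- The second order operator `φ ↦ ddᶜφ ∧ α₁ ∧ ⋯ ∧ αₘ₋₁ ∧ βⁿ⁻ᵐ` is a sum of squares of directional
derivatives. -/
theorem exists_hessianWedge_eq_sum {n m : ℕ} (hm : 1 ≤ m) (hmn : m ≤ n)
    {α : ℕ → Matrix (Fin n) (Fin n) ℂ} (hα : ∀ j, α j ∈ gardingCone n m) :
    ∃ (N : ℕ) (w : Fin N × Fin 2 → Cn n), ∀ (φ : Cn n → ℝ) (z : Cn n),
      hessianWedge m α φ z = ∑ l, fderiv ℝ (fderiv ℝ φ) z (w l) (w l) := by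
  obtain ⟨N, c, hc⟩ := exists_hessianForm_eq_sum hm hmn hα
  -- The Levi form at `c` is a quarter of the sum of the second derivatives along `c` and `i c`; the
  -- factor `1 / 2` on each direction absorbs the quarter.
  refine ⟨N, fun l => (1 / 2 : ℝ) • (if l.2 = 0 then (1 : ℂ) else Complex.I) •
    (WithLp.toLp 2 (c l.1) : Cn n), fun φ z => ?_⟩
  have h1 : hessianWedge m α φ z = (hessianForm α hm hmn (complexHessian φ z)).re := by
    rw [hessianForm_apply, wedgeForm_apply]
    rfl
  rw [h1, hc, Complex.re_sum, Fintype.sum_prod_type]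
  refine Finset.sum_congr rfl fun l _ => ?_
  set D := fderiv ℝ (fderiv ℝ φ) z
  have h2 : (WithLp.toLp 2 (c l) : Cn n) = ∑ j, c l j • EuclideanSpace.single j (1 : ℂ) := by
    ext i
    simp [Finset.sum_apply, Pi.single_apply]
  have h3 : ∑ j, ∑ k, c l j * star (c l k) * complexHessian φ z j k =
      leviForm D (WithLp.toLp 2 (c l)) (WithLp.toLp 2 (c l)) := by
    rw [h2]
    simp only [map_sum, LinearMap.sum_apply, map_smul, LinearMap.smul_apply, LinearMap.map_smulₛₗ]
    rw [Finset.sum_comm]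
    refine Finset.sum_congr rfl fun k _ => ?_
    rw [smul_eq_mul, Finset.mul_sum]
    refine Finset.sum_congr rfl fun j _ => ?_
    rw [complexHessian_eq_leviForm]
    simp only [smul_eq_mul, Complex.star_def]
    ring
  rw [h3, leviForm_self_re, Fin.sum_univ_two]
  simp
  ring

/-! ### Second differences and second derivatives -/

/-- The symmetric second difference is controlled by the oscillation of the second derivative. -/
theorem abs_symm_second_diff_sub_le {g g' g'' : ℝ → ℝ} (hg : ∀ t, HasDerivAt g (g' t) t)
    (hg' : ∀ t, HasDerivAt g' (g'' t) t) {δ s : ℝ} (hs : 0 ≤ s)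
    (h : ∀ t, |t| ≤ s → |g'' t - g'' 0| ≤ δ) :
    |g s + g (-s) - 2 * g 0 - s ^ 2 * g'' 0| ≤ 2 * δ * s ^ 2 := by
  have hδ : 0 ≤ δ := (abs_nonneg _).trans (h 0 (by simpa using hs))
  have hneg : ∀ {f f' : ℝ → ℝ}, (∀ t, HasDerivAt f (f' t) t) →
      ∀ t, HasDerivAt (fun t => f (-t)) (-f' (-t)) t := by
    intro f f' hf t
    exact ((hf (-t)).comp t (hasDerivAt_neg t)).congr_deriv (by simp)
  have h1 : ∀ t, HasDerivAt (fun t => g' t - g' (-t) - 2 * t * g'' 0)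
      (g'' t + g'' (-t) - 2 * g'' 0) t := by
    intro t
    have := ((hg' t).sub (hneg hg' t)).sub (((hasDerivAt_id t).const_mul 2).mul_const (g'' 0))
    exact this.congr_deriv (by simp)
  have h0 : ∀ t, HasDerivAt (fun t => g t + g (-t) - 2 * g 0 - t ^ 2 * g'' 0)
      (g' t - g' (-t) - 2 * t * g'' 0) t := by
    intro t
    have := (((hg t).add (hneg hg t)).sub_const (2 * g 0)).sub
      ((hasDerivAt_pow 2 t).mul_const (g'' 0))
    exact this.congr_deriv (by simp [sub_eq_add_neg])
  have hk : ∀ t ∈ Icc 0 s, |g' t - g' (-t) - 2 * t * g'' 0| ≤ 2 * δ * s := by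
    intro t ht
    have := norm_image_sub_le_of_norm_deriv_le_segment' (a := 0) (b := s) (C := 2 * δ)
      (fun x _ => (h1 x).hasDerivWithinAt) (fun x hx => ?_) t ht
    · simp only [neg_zero, sub_self, mul_zero, zero_mul, sub_zero, Real.norm_eq_abs] at this
      exact this.trans (mul_le_mul_of_nonneg_left ht.2 (by positivity))
    · have h3 := h x (by rw [abs_of_nonneg hx.1]; exact hx.2.le)
      have h4 := h (-x) (by rw [abs_neg, abs_of_nonneg hx.1]; exact hx.2.le)
      rw [Real.norm_eq_abs]
      rw [abs_le] at *
      constructor <;> linarith [h3.1, h3.2, h4.1, h4.2]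
  have := norm_image_sub_le_of_norm_deriv_le_segment' (a := 0) (b := s) (C := 2 * δ * s)
      (fun x _ => (h0 x).hasDerivWithinAt) (fun x hx => hk x ⟨hx.1, hx.2.le⟩) s ⟨hs, le_rfl⟩
  simp only [neg_zero, Real.norm_eq_abs] at this
  calc _ = |g s + g (-s) - 2 * g 0 - s ^ 2 * g'' 0 - (g 0 + g 0 - 2 * g 0 - 0 ^ 2 * g'' 0)| := by
        congr 1; ring
    _ ≤ 2 * δ * s * (s - 0) := this
    _ = 2 * δ * s ^ 2 := by ring

section secondDiff

variable {E : Type*} [NormedAddCommGroup E] [NormedSpace ℝ E] {ι : Type*} [Fintype ι]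

/-- The sum of the symmetric second differences of `φ` in the directions `w l`, with step `s`. -/
def secondDiff (w : ι → E) (s : ℝ) (φ : E → ℝ) (x : E) : ℝ :=
  ∑ l, (φ (x + s • w l) + φ (x - s • w l) - 2 * φ x)

/-- The sum of the second derivatives of `φ` in the directions `w l`. -/
noncomputable def dirLaplacian (w : ι → E) (φ : E → ℝ) (x : E) : ℝ :=
  ∑ l, fderiv ℝ (fderiv ℝ φ) x (w l) (w l)

variable {w : ι → E} {φ ψ : E → ℝ}

theorem tsupport_dirLaplacian_subset : tsupport (dirLaplacian w φ) ⊆ tsupport φ := by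
  refine closure_minimal (fun x hx => ?_) (isClosed_tsupport φ)
  by_contra h
  have h1 : x ∉ tsupport (fderiv ℝ (fderiv ℝ φ)) := fun h' =>
    h (tsupport_fderiv_subset ℝ (tsupport_fderiv_subset ℝ h'))
  refine hx ?_
  simp [dirLaplacian, image_eq_zero_of_notMem_tsupport h1]

theorem HasCompactSupport.dirLaplacian (h : HasCompactSupport φ) :
    HasCompactSupport (dirLaplacian w φ) :=
  h.of_isClosed_subset (isClosed_tsupport _) tsupport_dirLaplacian_subset

theorem ContDiff.contDiff_fderiv {F : Type*} [NormedAddCommGroup F] [NormedSpace ℝ F] {φ : E → F}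
    (h : ContDiff ℝ (⊤ : ℕ∞) φ) : ContDiff ℝ (⊤ : ℕ∞) (fderiv ℝ φ) :=
  (contDiff_infty_iff_fderiv.1 h).2

theorem ContDiff.continuous_fderiv_fderiv (h : ContDiff ℝ (⊤ : ℕ∞) φ) :
    Continuous (fderiv ℝ (fderiv ℝ φ)) :=
  h.contDiff_fderiv.contDiff_fderiv.continuous

theorem ContDiff.continuous_dirLaplacian (h : ContDiff ℝ (⊤ : ℕ∞) φ) :
    Continuous (dirLaplacian w φ) := by
  have := h.continuous_fderiv_fderiv
  unfold _root_.dirLaplacian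
  fun_prop

theorem dirLaplacian_add (hφ : ContDiff ℝ (⊤ : ℕ∞) φ) (hψ : ContDiff ℝ (⊤ : ℕ∞) ψ) (x : E) :
    dirLaplacian w (fun x => φ x + ψ x) x = dirLaplacian w φ x + dirLaplacian w ψ x := by
  have h1 : fderiv ℝ (fun x => φ x + ψ x) = fun x => fderiv ℝ φ x + fderiv ℝ ψ x := by
    ext1 x
    exact fderiv_fun_add (hφ.differentiable (by simp) x) (hψ.differentiable (by simp) x)
  have hd : ∀ {f : E → ℝ}, ContDiff ℝ (⊤ : ℕ∞) f → DifferentiableAt ℝ (fderiv ℝ f) x := fun hf =>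
    hf.contDiff_fderiv.differentiable (by simp) x
  simp only [dirLaplacian, h1]
  rw [fderiv_fun_add (hd hφ) (hd hψ), ← Finset.sum_add_distrib]
  rfl

theorem dirLaplacian_comp_sub (a x : E) :
    dirLaplacian w (fun y => φ (y - a)) x = dirLaplacian w φ (x - a) := by
  have h1 : fderiv ℝ (fun y => φ (y - a)) = fun y => fderiv ℝ φ (y - a) := by
    ext1 y
    exact fderiv_comp_sub a
  simp only [dirLaplacian, h1]
  rw [fderiv_comp_sub (f := fderiv ℝ φ)]

/-- The error is uniform in `x` because compact support makes the second derivative uniformly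
continuous. -/
theorem secondDiff_sub_dirLaplacian_le (hφ : ContDiff ℝ (⊤ : ℕ∞) φ) (hc : HasCompactSupport φ)
    {δ : ℝ} (hδ : 0 < δ) : ∀ᶠ s in 𝓝[>] (0 : ℝ), ∀ x,
      |secondDiff w s φ x - s ^ 2 * dirLaplacian w φ x| ≤ δ * s ^ 2 := by
  set H := fderiv ℝ (fderiv ℝ φ)
  have key : ∀ l, ∀ η : ℝ, 0 < η → ∀ᶠ s in 𝓝[>] (0 : ℝ), ∀ x,
      |φ (x + s • w l) + φ (x - s • w l) - 2 * φ x - s ^ 2 * H x (w l) (w l)| ≤ η * s ^ 2 := by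
    intro l η hη
    have hHc : HasCompactSupport fun x => H x (w l) (w l) :=
      ((hc.fderiv ℝ).fderiv ℝ).comp_left (g := fun A : E →L[ℝ] E →L[ℝ] ℝ => A (w l) (w l)) rfl
    have hHcont : Continuous fun x => H x (w l) (w l) := by
      have := hφ.continuous_fderiv_fderiv
      fun_prop
    obtain ⟨r, hr, hr'⟩ := Metric.uniformContinuous_iff.1
      (hHc.uniformContinuous_of_continuous hHcont) (η / 2) (by positivity)
    have hs0 : 0 < r / (‖w l‖ + 1) := by positivity
    filter_upwards [Ioo_mem_nhdsGT hs0] with s hs x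
    have hline : ∀ t : ℝ, HasDerivAt (fun t : ℝ => x + t • w l) (w l) t := by
      intro t
      simpa using ((hasDerivAt_id t).smul_const (w l)).const_add x
    have hg : ∀ t : ℝ, HasDerivAt (fun t : ℝ => φ (x + t • w l))
        (fderiv ℝ φ (x + t • w l) (w l)) t := fun t =>
      (hφ.differentiable (by simp) _).hasFDerivAt.comp_hasDerivAt t (hline t)
    have hg' : ∀ t : ℝ, HasDerivAt (fun t : ℝ => fderiv ℝ φ (x + t • w l) (w l))
        (H (x + t • w l) (w l) (w l)) t := by
      intro t
      have := (hφ.contDiff_fderiv.differentiable (by simp)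
        (x + t • w l)).hasFDerivAt.comp_hasDerivAt t (hline t)
      exact (this.clm_apply (hasDerivAt_const t (w l))).congr_deriv (by simp [H])
    have := abs_symm_second_diff_sub_le hg hg' hs.1.le
      (δ := η / 2) (fun t ht => ?_)
    · simp only [zero_smul, add_zero, neg_smul, ← sub_eq_add_neg] at this
      refine this.trans (le_of_eq ?_)
      field_simp
    · simp only [zero_smul, add_zero]
      have h1 : dist (x + t • w l) x < r := by
        rw [dist_eq_norm, add_sub_cancel_left, norm_smul, Real.norm_eq_abs]
        have h2 : s * (‖w l‖ + 1) < r := (lt_div_iff₀ (by positivity)).1 hs.2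
        have h3 : |t| * ‖w l‖ ≤ s * ‖w l‖ := mul_le_mul_of_nonneg_right ht (norm_nonneg _)
        nlinarith [hs.1]
      exact (hr' h1).le
  have hη : 0 < δ / (Fintype.card ι + 1) := by positivity
  filter_upwards [eventually_all.2 fun l => key l _ hη] with s hs x
  rw [secondDiff, dirLaplacian, Finset.mul_sum, ← Finset.sum_sub_distrib]
  refine (Finset.abs_sum_le_sum_abs _ _).trans
    ((Finset.sum_le_card_nsmul _ _ _ fun l _ => hs l x).trans ?_)
  rw [nsmul_eq_mul, Finset.card_univ, ← mul_assoc]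
  refine mul_le_mul_of_nonneg_right ?_ (sq_nonneg s)
  rw [mul_div_assoc', div_le_iff₀ (by positivity)]
  nlinarith

/-- At `x` the maximum equals one of the two functions, and at the neighbouring points it is at
least that function. -/
theorem secondDiff_max_ge {u v : E → ℝ} {s a : ℝ} {x : E} (hu : a ≤ secondDiff w s u x)
    (hv : a ≤ secondDiff w s v x) : a ≤ secondDiff w s (fun y => max (u y) (v y)) x := by
  rcases le_total (v x) (u x) with h | h
  · refine hu.trans (Finset.sum_le_sum fun l _ => ?_)
    simp only [max_eq_left h]
    gcongr <;> exact le_max_left _ _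
  · refine hv.trans (Finset.sum_le_sum fun l _ => ?_)
    simp only [max_eq_right h]
    gcongr <;> exact le_max_right _ _

theorem Continuous.secondDiff {φ : E → ℝ} (hφ : Continuous φ) (s : ℝ) :
    Continuous (_root_.secondDiff w s φ) := by
  unfold _root_.secondDiff
  fun_prop

end secondDiff

theorem nonneg_of_forall_pos_add_mul {a C : ℝ} (h : ∀ δ : ℝ, 0 < δ → 0 ≤ a + δ * C) : 0 ≤ a := by
  have h1 : Tendsto (fun δ : ℝ => a + δ * C) (𝓝[>] 0) (𝓝 (a + 0 * C)) :=
    (Continuous.tendsto (by fun_prop) 0).mono_left nhdsWithin_le_nhds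
  rw [zero_mul, add_zero] at h1
  exact ge_of_tendsto h1 (eventually_nhdsWithin_of_forall h)

/-! ### Distributional subsolutions and their maxima -/

section distributional

variable {E : Type*} [NormedAddCommGroup E] [NormedSpace ℝ E] [MeasureSpace E]
  [BorelSpace E] [FiniteDimensional ℝ E] [(volume : Measure E).IsAddHaarMeasure]
  {ι : Type*} [Fintype ι] {w : ι → E}

omit [FiniteDimensional ℝ E] in
-- Discrete integration by parts, from translation invariance of the measure; no smoothness is
-- needed.
theorem integral_mul_secondDiff {f g : E → ℝ} (hf : Continuous f) (hg : Continuous g)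
    (hgc : HasCompactSupport g) (s : ℝ) :
    ∫ x, f x * secondDiff w s g x = ∫ x, secondDiff w s f x * g x := by
  have hint : ∀ a b : E, Integrable fun x => f (x + a) * g (x + b) := by
    intro a b
    refine Continuous.integrable_of_hasCompactSupport (by fun_prop) ?_
    exact (hgc.comp_homeomorph (Homeomorph.addRight b)).mul_left
  have htr : ∀ a : E, ∫ x, f x * g (x + a) = ∫ x, f (x - a) * g x := by
    intro a
    rw [← integral_add_right_eq_self (fun x => f (x - a) * g x) a]
    simp
  have hint1 : ∀ a : E, Integrable fun x => f x * g (x + a) := fun a => by simpa using hint 0 a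
  have hint2 : ∀ a : E, Integrable fun x => f (x + a) * g x := fun a => by simpa using hint a 0
  simp only [secondDiff, Finset.mul_sum, Finset.sum_mul, sub_eq_add_neg]
  rw [integral_finsetSum, integral_finsetSum]
  · refine Finset.sum_congr rfl fun l _ => ?_
    have e1 : ∀ x, f x * (g (x + s • w l) + g (x + -(s • w l)) + -(2 * g x)) =
        f x * g (x + s • w l) + f x * g (x + -(s • w l)) - 2 * (f x * g x) := fun x => by ring
    have e2 : ∀ x, (f (x + s • w l) + f (x + -(s • w l)) + -(2 * f x)) * g x =
        f (x + -(s • w l)) * g x + f (x + s • w l) * g x - 2 * (f x * g x) := fun x => by ring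
    have h0 : Integrable fun x => f x * g x := by simpa using hint 0 0
    simp only [e1, e2]
    have i1 : Integrable fun x => f x * g (x + s • w l) + f x * g (x + -(s • w l)) :=
      (hint1 _).add (hint1 _)
    have i2 : Integrable fun x => f (x + -(s • w l)) * g x + f (x + s • w l) * g x :=
      (hint2 _).add (hint2 _)
    rw [integral_sub i1 (h0.const_mul 2), integral_add (hint1 _) (hint1 _),
      integral_sub i2 (h0.const_mul 2), integral_add (hint2 _) (hint2 _), htr, htr]
    simp only [sub_eq_add_neg, neg_neg]
  · intro l _
    refine Continuous.integrable_of_hasCompactSupport (by fun_prop) hgc.mul_left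
  · intro l _
    refine Continuous.integrable_of_hasCompactSupport (by fun_prop) ?_
    refine HasCompactSupport.mul_left ?_
    refine ((HasCompactSupport.add ?_ ?_)).add ?_
    · exact hgc.comp_homeomorph (Homeomorph.addRight _)
    · exact hgc.comp_homeomorph (Homeomorph.addRight _)
    · exact (HasCompactSupport.mul_left hgc).neg

omit [FiniteDimensional ℝ E] in
theorem integral_mul_secondDiff_sub_le {f φ : E → ℝ} (hf : Continuous f)
    (hfc : HasCompactSupport f) (hφ : ContDiff ℝ (⊤ : ℕ∞) φ) {δ s : ℝ}
    (h : ∀ x, |secondDiff w s φ x - s ^ 2 * dirLaplacian w φ x| ≤ δ * s ^ 2) :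
    |(∫ x, f x * secondDiff w s φ x) - s ^ 2 * ∫ x, f x * dirLaplacian w φ x| ≤
      δ * s ^ 2 * ∫ x, |f x| := by
  have h1 := Continuous.secondDiff (w := w) hφ.continuous s
  have h2 := hφ.continuous_dirLaplacian (w := w)
  rw [← integral_const_mul, ← integral_sub, ← integral_const_mul]
  · refine abs_integral_le_integral_abs.trans (integral_mono ?_ ?_ fun x => ?_)
    · exact ((((hf.mul h1).sub (continuous_const.mul (hf.mul h2)))).integrable_of_hasCompactSupport
        (hfc.mul_right.sub (HasCompactSupport.mul_left hfc.mul_right))).abs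
    · exact ((hf.integrable_of_hasCompactSupport hfc).abs.const_mul _)
    · have : f x * secondDiff w s φ x - s ^ 2 * (f x * dirLaplacian w φ x) =
          (secondDiff w s φ x - s ^ 2 * dirLaplacian w φ x) * f x := by ring
      simp only
      rw [this, abs_mul]
      exact mul_le_mul_of_nonneg_right (h x) (abs_nonneg _)
  · exact (hf.mul h1).integrable_of_hasCompactSupport hfc.mul_right
  · exact ((hf.mul h2).integrable_of_hasCompactSupport hfc.mul_right).const_mul _

/-- `u` satisfies `∑ ∂²u/∂w² ≥ 0` on `W` in the sense of distributions. -/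
def IsDistribSubsolution (w : ι → E) (W : Set E) (u : E → ℝ) : Prop :=
  ∀ ψ : E → ℝ, ContDiff ℝ (⊤ : ℕ∞) ψ → HasCompactSupport ψ → tsupport ψ ⊆ W → (∀ x, 0 ≤ ψ x) →
    0 ≤ ∫ x, u x * dirLaplacian w ψ x

omit [FiniteDimensional ℝ E] in
/-- Asymptotic nonnegativity of second differences implies the distributional inequality. -/
theorem integral_mul_dirLaplacian_nonneg {h φ : E → ℝ} (hh : Continuous h)
    (hhc : HasCompactSupport h) (hφ : ContDiff ℝ (⊤ : ℕ∞) φ) (hφc : HasCompactSupport φ)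
    (hφ0 : ∀ x, 0 ≤ φ x) (hd : ∀ δ : ℝ, 0 < δ → ∀ᶠ s in 𝓝[>] (0 : ℝ), ∀ x ∈ tsupport φ,
      -(δ * s ^ 2) ≤ secondDiff w s h x) : 0 ≤ ∫ x, h x * dirLaplacian w φ x := by
  refine nonneg_of_forall_pos_add_mul (C := (∫ x, |h x|) + ∫ x, φ x) fun δ hδ => ?_
  obtain ⟨s, ⟨h1, h2⟩, hs⟩ := ((hd δ hδ).and
    (secondDiff_sub_dirLaplacian_le (w := w) hφ hφc hδ)).and self_mem_nhdsWithin |>.exists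
  have hs' : 0 < s ^ 2 := pow_pos hs 2
  have h3 := (abs_le.1 (integral_mul_secondDiff_sub_le hh hhc hφ h2)).2
  have h4 : -(δ * s ^ 2) * ∫ x, φ x ≤ ∫ x, h x * secondDiff w s φ x := by
    rw [integral_mul_secondDiff hh hφ.continuous hφc, ← integral_const_mul]
    have hsd := Continuous.secondDiff (w := w) hh s
    refine integral_mono ((hφ.continuous.integrable_of_hasCompactSupport hφc).const_mul _)
      ((hsd.mul hφ.continuous).integrable_of_hasCompactSupport hφc.mul_left) fun x => ?_
    by_cases hx : x ∈ tsupport φ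
    · exact mul_le_mul_of_nonneg_right (h1 x hx) (hφ0 x)
    · simp [image_eq_zero_of_notMem_tsupport hx]
  by_contra! hneg
  nlinarith

omit [FiniteDimensional ℝ E] in
-- The second difference falls on the kernel, where it is `s²` times the operator up to a small
-- error. Tested against the translated kernel, `u` gives a nonnegative main term. The error is
-- uniform in `x` since translation commutes with the operator.
theorem secondDiff_mollify_ge {u ρ : E → ℝ} {K W : Set E} (hu : Continuous u)
    (huc : HasCompactSupport u) (hsub : IsDistribSubsolution w W u) (hρ : ContDiff ℝ (⊤ : ℕ∞) ρ)
    (hρc : HasCompactSupport ρ) (hρ0 : ∀ x, 0 ≤ ρ x)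
    (hK : ∀ x ∈ K, ∀ y ∈ tsupport ρ, y + x ∈ W) {δ : ℝ} (hδ : 0 < δ) :
    ∀ᶠ s in 𝓝[>] (0 : ℝ), ∀ x ∈ K,
      -(δ * s ^ 2) ≤ secondDiff w s (fun x => ∫ y, u y * ρ (y - x)) x := by
  have hη : 0 < δ / ((∫ y, |u y|) + 1) := by positivity
  filter_upwards [secondDiff_sub_dirLaplacian_le (w := w) hρ hρc hη, self_mem_nhdsWithin]
    with s hs hs0 x hx
  have hρx : ContDiff ℝ (⊤ : ℕ∞) fun y => ρ (y - x) := hρ.comp (contDiff_id.sub contDiff_const)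
  have hsupp : tsupport (fun y => ρ (y - x)) = (fun y => y - x) ⁻¹' tsupport ρ :=
    (tsupport_comp_eq_preimage ρ (Homeomorph.subRight x))
  have hρxc : HasCompactSupport fun y => ρ (y - x) :=
    hρc.comp_homeomorph (Homeomorph.subRight x)
  have h1 : secondDiff w s (fun x => ∫ y, u y * ρ (y - x)) x =
      ∫ y, u y * secondDiff w s (fun y => ρ (y - x)) y := by
    have hint : ∀ a : E, Integrable fun y => u y * ρ (y - a) := fun a =>
      Continuous.integrable_of_hasCompactSupport
        (hu.mul (hρ.continuous.comp (by fun_prop))) huc.mul_right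
    have hρ' := hρ.continuous
    simp only [secondDiff, Finset.mul_sum]
    rw [integral_finsetSum]
    · refine Finset.sum_congr rfl fun l _ => ?_
      have e1 : ∀ y, u y * (ρ (y + s • w l - x) + ρ (y - s • w l - x) - 2 * ρ (y - x)) =
          u y * ρ (y - (x + s • w l)) + u y * ρ (y - (x - s • w l)) - 2 * (u y * ρ (y - x)) := by
        intro y
        rw [show y + s • w l - x = y - (x - s • w l) by abel,
          show y - s • w l - x = y - (x + s • w l) by abel]
        ring
      simp only [e1]
      have i1 : Integrable fun y => u y * ρ (y - (x + s • w l)) + u y * ρ (y - (x - s • w l)) :=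
        (hint _).add (hint _)
      rw [integral_sub i1 ((hint _).const_mul 2),
        integral_add (hint _) (hint _), integral_const_mul]
    · intro l _
      exact Continuous.integrable_of_hasCompactSupport (by fun_prop) huc.mul_right
  have h2 := integral_mul_secondDiff_sub_le (w := w) hu huc hρx
    (δ := δ / ((∫ y, |u y|) + 1)) (s := s) (fun y => by
      have : secondDiff w s (fun y => ρ (y - x)) y = secondDiff w s ρ (y - x) := by
        simp only [secondDiff]
        refine Finset.sum_congr rfl fun l _ => ?_
        rw [show y + s • w l - x = y - x + s • w l by abel,
          show y - s • w l - x = y - x - s • w l by abel]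
      rw [this, dirLaplacian_comp_sub]
      exact hs _)
  have h3 := hsub _ hρx hρxc (by
    rw [hsupp]
    intro y hy
    simpa using hK x hx _ hy) fun y => hρ0 _
  rw [h1]
  have h4 := (abs_le.1 h2).1
  have h5 : 0 ≤ s ^ 2 * ∫ y, u y * dirLaplacian w (fun y => ρ (y - x)) y := by positivity
  have h6 : δ / ((∫ y, |u y|) + 1) * s ^ 2 * ∫ y, |u y| ≤ δ * s ^ 2 := by
    have h0 : 0 ≤ ∫ y, |u y| := integral_nonneg fun y => abs_nonneg _
    rw [mul_right_comm]
    refine mul_le_mul_of_nonneg_right ?_ (sq_nonneg s)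
    rw [div_mul_eq_mul_div, div_le_iff₀ (by positivity)]
    nlinarith
  linarith

end distributional

/-- Smooth cutoff functions. -/
theorem IsCompact.exists_contDiff_cutoff {E : Type*} [NormedAddCommGroup E] [NormedSpace ℝ E]
    [FiniteDimensional ℝ E] {K U : Set E} (hK : IsCompact K) (hU : IsOpen U) (hKU : K ⊆ U) :
    ∃ (χ : E → ℝ) (W : Set E), ContDiff ℝ (⊤ : ℕ∞) χ ∧ HasCompactSupport χ ∧ tsupport χ ⊆ U ∧
      (∀ x, χ x ∈ Icc (0 : ℝ) 1) ∧ IsOpen W ∧ K ⊆ W ∧ W ⊆ U ∧ ∀ x ∈ W, χ x = 1 := by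
  obtain ⟨K1, hK1, h1, h1U⟩ := exists_compact_between hK hU hKU
  obtain ⟨K2, hK2, h2, h2U⟩ := exists_compact_between hK1 hU h1U
  obtain ⟨f, hf0, hf1, hf⟩ := exists_contMDiffMap_zero_one_of_isClosed (n := (⊤ : ℕ∞))
    (modelWithCornersSelf ℝ E) (s := (interior K2)ᶜ) (t := K1) isOpen_interior.isClosed_compl
    hK1.isClosed (disjoint_compl_left_iff_subset.2 h2)
  have hsupp : tsupport f ⊆ K2 := by
    refine closure_minimal (fun x hx => ?_) hK2.isClosed
    by_contra h
    exact hx (hf0 fun h' => h (interior_subset h'))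
  exact ⟨f, interior K1, f.contMDiff.contDiff, hK2.of_isClosed_subset (isClosed_tsupport _) hsupp,
    hsupp.trans h2U, hf, isOpen_interior, h1, interior_subset.trans h1U,
    fun x hx => hf1 (interior_subset hx)⟩

theorem ContinuousOn.continuous_mul_of_tsupport_subset {X : Type*} [TopologicalSpace X]
    {u f : X → ℝ} {U : Set X} (hU : IsOpen U) (hu : ContinuousOn u U) (hf : Continuous f)
    (hfU : tsupport f ⊆ U) : Continuous fun x => u x * f x := by
  refine continuous_of_tsupport fun x hx => ?_
  have hx' : x ∈ tsupport f := closure_mono (Function.support_mul_subset_right u f) hx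
  exact (hu.continuousAt (hU.mem_nhds (hfU hx'))).mul hf.continuousAt

section distributional

variable {E : Type*} [NormedAddCommGroup E] [NormedSpace ℝ E] [MeasureSpace E]
  [BorelSpace E] [FiniteDimensional ℝ E] [(volume : Measure E).IsAddHaarMeasure]
  {ι : Type*} [Fintype ι] {w : ι → E} {u v : E → ℝ} {U V : Set E}

omit [FiniteDimensional ℝ E] in
theorem integrable_mul_dirLaplacian (hU : IsOpen U) (hu : ContinuousOn u U) {φ : E → ℝ}
    (hφ : ContDiff ℝ (⊤ : ℕ∞) φ) (hφc : HasCompactSupport φ) (hφU : tsupport φ ⊆ U) :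
    Integrable fun x => u x * dirLaplacian w φ x :=
  (hu.continuous_mul_of_tsupport_subset hU hφ.continuous_dirLaplacian
    (tsupport_dirLaplacian_subset.trans hφU)).integrable_of_hasCompactSupport
      hφc.dirLaplacian.mul_left

omit [FiniteDimensional ℝ E] in
theorem integrable_dirLaplacian {φ : E → ℝ} (hφ : ContDiff ℝ (⊤ : ℕ∞) φ)
    (hφc : HasCompactSupport φ) : Integrable (dirLaplacian w φ) :=
  hφ.continuous_dirLaplacian.integrable_of_hasCompactSupport hφc.dirLaplacian

namespace IsDistribSubsolution

omit [BorelSpace E] [FiniteDimensional ℝ E] [(volume : Measure E).IsAddHaarMeasure]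

theorem mono (h : IsDistribSubsolution w U u) (hVU : V ⊆ U) : IsDistribSubsolution w V u :=
  fun ψ h1 h2 h3 => h ψ h1 h2 (h3.trans hVU)

theorem congr (h : IsDistribSubsolution w U u) (huv : EqOn u v U) :
    IsDistribSubsolution w U v := by
  intro ψ h1 h2 h3 h4
  convert h ψ h1 h2 h3 h4 using 3 with x
  by_cases hx : x ∈ tsupport ψ
  · rw [huv (h3 hx)]
  · rw [image_eq_zero_of_notMem_tsupport fun h' => hx (tsupport_dirLaplacian_subset h'),
      mul_zero, mul_zero]

theorem const_mul (h : IsDistribSubsolution w U u) {c : ℝ} (hc : 0 ≤ c) :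
    IsDistribSubsolution w U fun x => c * u x := by
  intro ψ h1 h2 h3 h4
  simp only [mul_assoc]
  rw [integral_const_mul]
  exact mul_nonneg hc (h ψ h1 h2 h3 h4)

variable [BorelSpace E] [(volume : Measure E).IsAddHaarMeasure]

theorem add (hU : IsOpen U) (hu : ContinuousOn u U) (hv : ContinuousOn v U)
    (hus : IsDistribSubsolution w U u) (hvs : IsDistribSubsolution w U v) :
    IsDistribSubsolution w U fun x => u x + v x := by
  intro ψ h1 h2 h3 h4
  simp only [add_mul]
  rw [integral_add (integrable_mul_dirLaplacian hU hu h1 h2 h3)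
    (integrable_mul_dirLaplacian hU hv h1 h2 h3)]
  exact add_nonneg (hus ψ h1 h2 h3 h4) (hvs ψ h1 h2 h3 h4)

variable [FiniteDimensional ℝ E]

theorem const (c : ℝ) : IsDistribSubsolution w U fun _ => c := by
  intro ψ h1 h2 h3 h4
  rw [integral_const_mul]
  refine (mul_eq_zero_of_right c ?_).ge
  simp only [dirLaplacian]
  have hd : Differentiable ℝ (fderiv ℝ ψ) := h1.contDiff_fderiv.differentiable (by simp)
  have hd2 : ∀ l x, fderiv ℝ (fun x => fderiv ℝ ψ x (w l)) x (w l) =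
      fderiv ℝ (fderiv ℝ ψ) x (w l) (w l) := by
    intro l x
    rw [fderiv_clm_apply (hd x) (differentiableAt_const _)]
    simp
  have hc1 : ∀ l, HasCompactSupport fun x => fderiv ℝ ψ x (w l) := fun l =>
    (h2.fderiv ℝ).comp_left (g := fun A : E →L[ℝ] ℝ => A (w l)) rfl
  have hc2 : ∀ l, HasCompactSupport fun x => fderiv ℝ (fderiv ℝ ψ) x (w l) (w l) := fun l =>
    ((h2.fderiv ℝ).fderiv ℝ).comp_left (g := fun A : E →L[ℝ] E →L[ℝ] ℝ => A (w l) (w l)) rfl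
  have hcont1 := h1.contDiff_fderiv.continuous
  have hcont2 := h1.continuous_fderiv_fderiv
  have hi1 : ∀ l, Integrable fun x => fderiv ℝ ψ x (w l) := fun l =>
    Continuous.integrable_of_hasCompactSupport (by fun_prop) (hc1 l)
  have hi2 : ∀ l, Integrable fun x => fderiv ℝ (fderiv ℝ ψ) x (w l) (w l) := fun l =>
    Continuous.integrable_of_hasCompactSupport (by fun_prop) (hc2 l)
  rw [integral_finsetSum _ fun l _ => hi2 l]
  refine Finset.sum_eq_zero fun l _ => ?_
  have := integral_smul_fderiv_eq_neg_fderiv_smul_of_integrable (𝕜 := ℝ) (μ := volume)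
    (f := fun _ : E => (1 : ℝ)) (g := fun x => fderiv ℝ ψ x (w l)) (v := w l)
    (by simp) (by simpa [hd2] using hi2 l) (by simpa using hi1 l)
    (fun _ _ => differentiableAt_const _)
    (fun x _ => (hd x).clm_apply (differentiableAt_const _))
  simpa [hd2] using this

/-- The mollified functions have asymptotically nonnegative second differences near the support of
the test function, hence so does their maximum. Mollification changes the maximum by at most `η`,
which costs at most `η ∫ |dirLaplacian w φ|`. -/
theorem max_of_hasCompactSupport (hU : IsOpen U) (hu : Continuous u) (huc : HasCompactSupport u)
    (hv : Continuous v) (hvc : HasCompactSupport v) (hus : IsDistribSubsolution w U u)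
    (hvs : IsDistribSubsolution w U v) : IsDistribSubsolution w U fun x => max (u x) (v x) := by
  intro φ hφ hφc hφU hφ0
  obtain ⟨d, hd, hdU⟩ := hφc.isCompact.exists_cthickening_subset_open hU hφU
  refine nonneg_of_forall_pos_add_mul (C := ∫ x, |dirLaplacian w φ x|) fun η hη => ?_
  obtain ⟨r1, hr1, h1⟩ := Metric.uniformContinuous_iff.1
    (huc.uniformContinuous_of_continuous hu) η hη
  obtain ⟨r2, hr2, h2⟩ := Metric.uniformContinuous_iff.1
    (hvc.uniformContinuous_of_continuous hv) η hη
  -- `r1` and `r2` control the oscillations of `u` and `v`; `d` keeps the kernels centred on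
  -- `tsupport φ` inside `U`.
  set r := min (min r1 r2) d
  have hr : 0 < r := lt_min (lt_min hr1 hr2) hd
  let b : ContDiffBump (0 : E) := ⟨r / 2, r, by positivity, by linarith⟩
  set ρ : E → ℝ := b.normed volume
  have hρ : ContDiff ℝ (⊤ : ℕ∞) ρ := b.contDiff_normed
  have hρc : HasCompactSupport ρ := b.hasCompactSupport_normed
  have hρ0 : ∀ x, 0 ≤ ρ x := b.nonneg_normed
  have hρU : ∀ x ∈ tsupport φ, ∀ y ∈ tsupport ρ, y + x ∈ U := by
    intro x hx y hy
    rw [b.tsupport_normed_eq, mem_closedBall_zero_iff] at hy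
    refine hdU (Metric.mem_cthickening_of_dist_le _ x d _ hx ?_)
    rw [dist_eq_norm, add_sub_cancel_right]
    exact hy.trans (min_le_right _ _)
  let M : (E → ℝ) → E → ℝ := fun f x => ∫ y, f y * ρ (y - x)
  have hmoll : ∀ f : E → ℝ, M f =
      convolution ρ f (ContinuousLinearMap.lsmul ℝ ℝ) volume := by
    intro f
    ext x
    rw [convolution_eq_swap]
    refine integral_congr_ae (Eventually.of_forall fun y => ?_)
    have : ρ (x - y) = ρ (y - x) := by
      rw [← neg_sub]
      exact b.normed_neg (y - x)
    simp [this, mul_comm]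
  have hMcont : ∀ f : E → ℝ, Continuous f → HasCompactSupport f → Continuous (M f) := by
    intro f hf hfc
    rw [hmoll]
    exact hfc.continuous_convolution_right _ hρ.continuous.locallyIntegrable hf
  have hMc : ∀ f : E → ℝ, HasCompactSupport f → HasCompactSupport (M f) := by
    intro f hfc
    rw [hmoll]
    exact HasCompactSupport.convolution _ hρc hfc
  have hMu : ∀ x, |M u x - u x| ≤ η := by
    intro x
    rw [hmoll]
    refine ContDiffBump.dist_normed_convolution_le hu.aestronglyMeasurable fun y hy => ?_
    exact (h1 (lt_of_lt_of_le hy ((min_le_left _ _).trans (min_le_left _ _)))).le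
  have hMv : ∀ x, |M v x - v x| ≤ η := by
    intro x
    rw [hmoll]
    refine ContDiffBump.dist_normed_convolution_le hv.aestronglyMeasurable fun y hy => ?_
    exact (h2 (lt_of_lt_of_le hy ((min_le_left _ _).trans (min_le_right _ _)))).le
  have hhcont : Continuous fun x => max (M u x) (M v x) := (hMcont u hu huc).max (hMcont v hv hvc)
  have hmaxc : ∀ {f g : E → ℝ}, HasCompactSupport f → HasCompactSupport g →
      HasCompactSupport fun x => max (f x) (g x) := fun hf hg =>
    HasCompactSupport.comp₂_left hf hg (max_self 0)
  have hmain := integral_mul_dirLaplacian_nonneg (w := w) hhcont (hmaxc (hMc u huc) (hMc v hvc))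
    hφ hφc hφ0 fun δ hδ => by
      filter_upwards [secondDiff_mollify_ge hu huc hus hρ hρc hρ0 hρU hδ,
        secondDiff_mollify_ge hv hvc hvs hρ hρc hρ0 hρU hδ] with s hs1 hs2 x hx
      exact secondDiff_max_ge (hs1 x hx) (hs2 x hx)
  have hLint := integrable_dirLaplacian (w := w) hφ hφc
  have hint : ∀ f : E → ℝ, Continuous f → Integrable fun x => f x * dirLaplacian w φ x :=
    fun f hf => integrable_mul_dirLaplacian isOpen_univ hf.continuousOn hφ hφc (subset_univ _)
  rw [← integral_const_mul, ← integral_add (hint _ (hu.max hv)) (hLint.abs.const_mul _)]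
  refine hmain.trans (integral_mono (hint _ hhcont)
    ((hint _ (hu.max hv)).add (hLint.abs.const_mul _)) fun x => ?_)
  have h3 : |max (M u x) (M v x) - max (u x) (v x)| ≤ η :=
    (abs_max_sub_max_le_max _ _ _ _).trans (max_le (hMu x) (hMv x))
  have h4 : (max (M u x) (M v x) - max (u x) (v x)) * dirLaplacian w φ x ≤
      η * |dirLaplacian w φ x| := by
    refine (le_abs_self _).trans ?_
    rw [abs_mul]
    exact mul_le_mul_of_nonneg_right h3 (abs_nonneg _)
  simp only
  linarith

theorem max (hU : IsOpen U) (hu : ContinuousOn u U) (hv : ContinuousOn v U)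
    (hus : IsDistribSubsolution w U u) (hvs : IsDistribSubsolution w U v) :
    IsDistribSubsolution w U fun x => max (u x) (v x) := by
  intro φ hφ hφc hφU hφ0
  obtain ⟨χ, W, hχ, hχc, hχU, hχ01, hW, hφW, hWU, hχ1⟩ :=
    hφc.isCompact.exists_contDiff_cutoff hU hφU
  have hcut : ∀ f : E → ℝ, EqOn f (fun x => f x * χ x) W := fun f x hx => by
    simp [hχ1 x hx]
  have h := max_of_hasCompactSupport hW
    (hu.continuous_mul_of_tsupport_subset hU hχ.continuous hχU) hχc.mul_left
    (hv.continuous_mul_of_tsupport_subset hU hχ.continuous hχU) hχc.mul_left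
    ((hus.mono hWU).congr (hcut u)) ((hvs.mono hWU).congr (hcut v))
  refine h.congr (fun x hx => ?_) φ hφ hφc hφW hφ0
  simp [hχ1 x hx]

/-- Split the test function by a cutoff equal to `1` near the part of its support outside `V`: one
piece is supported in `U`, the other in `V`. -/
theorem union (hU : IsOpen U) (hV : IsOpen V) (hu : ContinuousOn u (U ∪ V))
    (h1 : IsDistribSubsolution w U u) (h2 : IsDistribSubsolution w V u) :
    IsDistribSubsolution w (U ∪ V) u := by
  intro φ hφ hφc hφU hφ0
  have hK : IsCompact (tsupport φ \ V) := hφc.isCompact.diff hV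
  have hKU : tsupport φ \ V ⊆ U := fun x hx => (hφU hx.1).resolve_right hx.2
  obtain ⟨χ, W, hχ, hχc, hχU, hχ01, hW, hφW, hWU, hχ1⟩ := hK.exists_contDiff_cutoff hU hKU
  have hs1 : tsupport (fun x => χ x * φ x) ⊆ U :=
    (tsupport_mul_subset_left (f := χ) (g := φ)).trans hχU
  have hs2 : tsupport (fun x => (1 - χ x) * φ x) ⊆ V := by
    intro x hx
    have hx1 : x ∈ tsupport φ := (tsupport_mul_subset_right (f := fun x => 1 - χ x) (g := φ)) hx
    have hx2 : x ∈ tsupport (fun x => 1 - χ x) :=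
      (tsupport_mul_subset_left (f := fun x => 1 - χ x) (g := φ)) hx
    have hx3 : tsupport (fun x => 1 - χ x) ⊆ Wᶜ :=
      closure_minimal (fun y hy hyW => hy (by simp [hχ1 y hyW])) hW.isClosed_compl
    by_contra h
    exact hx3 hx2 (hφW ⟨hx1, h⟩)
  have hd1 : ContDiff ℝ (⊤ : ℕ∞) fun x => χ x * φ x := hχ.mul hφ
  have hd2 : ContDiff ℝ (⊤ : ℕ∞) fun x => (1 - χ x) * φ x := (contDiff_const.sub hχ).mul hφ
  have hc1 : HasCompactSupport fun x => χ x * φ x := hφc.mul_left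
  have hc2 : HasCompactSupport fun x => (1 - χ x) * φ x := hφc.mul_left
  have heq : φ = fun x => χ x * φ x + (1 - χ x) * φ x := by
    ext x
    ring
  have hUV := hU.union hV
  rw [heq]
  simp only [dirLaplacian_add hd1 hd2, mul_add]
  rw [integral_add (integrable_mul_dirLaplacian hUV hu hd1 hc1 (hs1.trans subset_union_left))
    (integrable_mul_dirLaplacian hUV hu hd2 hc2 (hs2.trans subset_union_right))]
  exact add_nonneg (h1 _ hd1 hc1 hs1 fun x => mul_nonneg (hχ01 x).1 (hφ0 x))
    (h2 _ hd2 hc2 hs2 fun x => mul_nonneg (sub_nonneg.2 (hχ01 x).2) (hφ0 x))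

end IsDistribSubsolution

end distributional

/-! ### Stability properties of continuous `m`-subharmonic functions -/

section IsContMSubharmonicOn

variable {n m : ℕ} {u v : Cn n → ℝ} {U V : Set (Cn n)}

/-- The directions depend on `α` alone, so the same `w` serves for several functions and open sets
at once. -/
theorem isContMSubharmonicOn_current_iff (hm : 1 ≤ m) (hmn : m ≤ n)
    {α : ℕ → Matrix (Fin n) (Fin n) ℂ} (hα : ∀ j, α j ∈ gardingCone n m) :
    ∃ (N : ℕ) (w : Fin N × Fin 2 → Cn n), ∀ (u : Cn n → ℝ) (U : Set (Cn n)),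
      (∀ φ : Cn n → ℝ, ContDiff ℝ (⊤ : ℕ∞) φ → HasCompactSupport φ → tsupport φ ⊆ U →
        (∀ x, 0 ≤ φ x) → 0 ≤ ∫ x, u x * hessianWedge m α φ x) ↔ IsDistribSubsolution w U u := by
  obtain ⟨N, w, hw⟩ := exists_hessianWedge_eq_sum hm hmn hα
  refine ⟨N, w, fun u U => ?_⟩
  simp only [hw]
  rfl

theorem eventually_integrableOn_ball (hU : IsOpen U) (hu : ContinuousOn u U) {z : Cn n}
    (hz : z ∈ U) : ∀ᶠ r : ℝ in 𝓝[>] 0, Metric.ball z r ⊆ U ∧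
      IntegrableOn u (Metric.ball z r) ∧ volume (Metric.ball z r) ≠ 0 ∧
      volume (Metric.ball z r) ≠ ⊤ := by
  obtain ⟨ε, hε, hεU⟩ := Metric.isOpen_iff.1 hU z hz
  filter_upwards [Ioo_mem_nhdsGT hε] with r hr
  have hsub : Metric.closedBall z r ⊆ U := (Metric.closedBall_subset_ball hr.2).trans hεU
  exact ⟨Metric.ball_subset_closedBall.trans hsub,
    ((hu.mono hsub).integrableOn_compact (isCompact_closedBall z r)).mono_set
      Metric.ball_subset_closedBall, (Metric.measure_ball_pos volume z hr.1).ne',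
      measure_ball_lt_top.ne⟩

namespace IsContMSubharmonicOn

theorem mono (h : IsContMSubharmonicOn m u U) (hVU : V ⊆ U) : IsContMSubharmonicOn m u V where
  continuousOn := h.continuousOn.mono hVU
  subharmonic z hz := h.subharmonic z (hVU hz)
  current_nonneg α hα φ h1 h2 h3 := h.current_nonneg α hα φ h1 h2 (h3.trans hVU)

theorem congr (h : IsContMSubharmonicOn m u U) (hm : 1 ≤ m) (hmn : m ≤ n) (hU : IsOpen U)
    (huv : EqOn u v U) : IsContMSubharmonicOn m v U where
  continuousOn := h.continuousOn.congr huv.symm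
  subharmonic z hz := by
    filter_upwards [h.subharmonic z hz, eventually_integrableOn_ball hU h.continuousOn hz]
      with r hr hr'
    rw [← huv hz]
    refine hr.trans (le_of_eq (setAverage_congr_fun measurableSet_ball ?_))
    exact Eventually.of_forall fun x hx => huv (hr'.1 hx)
  current_nonneg α hα := by
    obtain ⟨N, w, hw⟩ := isContMSubharmonicOn_current_iff hm hmn hα
    exact (hw v U).2 (((hw u U).1 (h.current_nonneg α hα)).congr huv)

theorem const (hm : 1 ≤ m) (hmn : m ≤ n) (hU : IsOpen U) (c : ℝ) :
    IsContMSubharmonicOn m (fun _ : Cn n => c) U where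
  continuousOn := continuousOn_const
  subharmonic z hz := by
    filter_upwards [eventually_integrableOn_ball hU (continuousOn_const (c := c)) hz] with r hr
    rw [setAverage_const hr.2.2.1 hr.2.2.2]
  current_nonneg α hα := by
    obtain ⟨N, w, hw⟩ := isContMSubharmonicOn_current_iff hm hmn hα
    exact (hw _ U).2 (IsDistribSubsolution.const c)

theorem const_mul (hm : 1 ≤ m) (hmn : m ≤ n) (hu : IsContMSubharmonicOn m u U) {c : ℝ}
    (hc : 0 ≤ c) : IsContMSubharmonicOn m (fun x => c * u x) U where
  continuousOn := continuousOn_const.mul hu.continuousOn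
  subharmonic z hz := by
    filter_upwards [hu.subharmonic z hz] with r hr
    rw [setAverage_eq, integral_const_mul, smul_eq_mul, mul_left_comm, ← smul_eq_mul (_⁻¹),
      ← setAverage_eq]
    exact mul_le_mul_of_nonneg_left hr hc
  current_nonneg α hα := by
    obtain ⟨N, w, hw⟩ := isContMSubharmonicOn_current_iff hm hmn hα
    exact (hw _ U).2 (((hw u U).1 (hu.current_nonneg α hα)).const_mul hc)

theorem add (hm : 1 ≤ m) (hmn : m ≤ n) (hU : IsOpen U) (hu : IsContMSubharmonicOn m u U)
    (hv : IsContMSubharmonicOn m v U) : IsContMSubharmonicOn m (fun x => u x + v x) U where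
  continuousOn := hu.continuousOn.add hv.continuousOn
  subharmonic z hz := by
    filter_upwards [hu.subharmonic z hz, hv.subharmonic z hz,
      eventually_integrableOn_ball hU hu.continuousOn hz,
      eventually_integrableOn_ball hU hv.continuousOn hz] with r h1 h2 h3 h4
    rw [setAverage_eq, integral_add h3.2.1 h4.2.1, smul_add, ← setAverage_eq, ← setAverage_eq]
    exact add_le_add h1 h2
  current_nonneg α hα := by
    obtain ⟨N, w, hw⟩ := isContMSubharmonicOn_current_iff hm hmn hα
    exact (hw _ U).2 (((hw u U).1 (hu.current_nonneg α hα)).add hU hu.continuousOn hv.continuousOn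
      ((hw v U).1 (hv.current_nonneg α hα)))

theorem max (hm : 1 ≤ m) (hmn : m ≤ n) (hU : IsOpen U) (hu : IsContMSubharmonicOn m u U)
    (hv : IsContMSubharmonicOn m v U) :
    IsContMSubharmonicOn m (fun x => max (u x) (v x)) U where
  continuousOn := hu.continuousOn.sup hv.continuousOn
  subharmonic z hz := by
    filter_upwards [hu.subharmonic z hz, hv.subharmonic z hz,
      eventually_integrableOn_ball hU hu.continuousOn hz,
      eventually_integrableOn_ball hU hv.continuousOn hz] with r h1 h2 h3 h4
    rw [setAverage_eq, smul_eq_mul] at *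
    have h0 : 0 ≤ (volume.real (Metric.ball z r))⁻¹ := by positivity
    have hmax := h3.2.1.sup h4.2.1
    refine max_le (h1.trans ?_) (h2.trans ?_)
    · exact mul_le_mul_of_nonneg_left (integral_mono h3.2.1 hmax fun x => le_max_left _ _) h0
    · exact mul_le_mul_of_nonneg_left (integral_mono h4.2.1 hmax fun x => le_max_right _ _) h0
  current_nonneg α hα := by
    obtain ⟨N, w, hw⟩ := isContMSubharmonicOn_current_iff hm hmn hα
    exact (hw _ U).2 (((hw u U).1 (hu.current_nonneg α hα)).max hU hu.continuousOn hv.continuousOn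
      ((hw v U).1 (hv.current_nonneg α hα)))

theorem union (hm : 1 ≤ m) (hmn : m ≤ n) (hU : IsOpen U) (hV : IsOpen V)
    (h1 : IsContMSubharmonicOn m u U) (h2 : IsContMSubharmonicOn m u V) :
    IsContMSubharmonicOn m u (U ∪ V) where
  continuousOn := h1.continuousOn.union_of_isOpen h2.continuousOn hU hV
  subharmonic z hz := hz.elim (h1.subharmonic z) (h2.subharmonic z)
  current_nonneg α hα := by
    obtain ⟨N, w, hw⟩ := isContMSubharmonicOn_current_iff hm hmn hα
    exact (hw _ _).2 (((hw u U).1 (h1.current_nonneg α hα)).union hU hV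
      (h1.continuousOn.union_of_isOpen h2.continuousOn hU hV)
      ((hw u V).1 (h2.current_nonneg α hα)))

end IsContMSubharmonicOn

end IsContMSubharmonicOn

/-! ### Edwards' duality and uniform approximation -/

/-- Hahn–Banach from the line through `x`. On its negative half the domination is `0 = N 0 ≤ N (c x)
+ N (-c x)`. -/
theorem exists_linearMap_eq_of_sublinear {E : Type*} [AddCommGroup E] [Module ℝ E] (N : E → ℝ)
    (N_hom : ∀ c : ℝ, 0 < c → ∀ x, N (c • x) = c * N x) (N_add : ∀ x y, N (x + y) ≤ N x + N y)
    (x : E) : ∃ l : E →ₗ[ℝ] ℝ, l x = N x ∧ ∀ y, l y ≤ N y := by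
  have N0 : N 0 = 0 := by
    have := N_hom 2 two_pos 0
    rw [smul_zero] at this
    linarith
  have H : ∀ c : ℝ, c • x = 0 → (RingHom.id ℝ) c • N x = 0 := by
    intro c hc
    rcases smul_eq_zero.1 hc with rfl | rfl
    · simp
    · simp [N0]
  obtain ⟨l, hl, hlN⟩ := exists_extension_of_le_sublinear (LinearPMap.mkSpanSingleton' x (N x) H)
    N N_hom N_add (by
      rintro ⟨y, hy⟩
      obtain ⟨c, rfl⟩ := Submodule.mem_span_singleton.1 hy
      rw [LinearPMap.mkSpanSingleton'_apply]
      simp only [RingHom.id_apply, smul_eq_mul]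
      rcases lt_trichotomy c 0 with hc | rfl | hc
      · have h1 := N_hom (-c) (neg_pos.2 hc) x
        have h2 := N_add (c • x) (-c • x)
        rw [← add_smul, add_neg_cancel, zero_smul, N0] at h2
        linarith
      · simp [N0]
      · exact (N_hom c hc x).ge)
  refine ⟨l, ?_, hlN⟩
  have hx := Submodule.mem_span_singleton_self (R := ℝ) x
  rw [hl ⟨x, hx⟩]
  exact LinearPMap.mkSpanSingleton'_apply_self _ _ _ _

section Edwards

variable {n m : ℕ} {X : Set (Cn n)}

/-- `f` is continuous and `m`-subharmonic on some open neighbourhood of `X`. -/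
def IsMSubharmonicNear (m : ℕ) (X : Set (Cn n)) (f : Cn n → ℝ) : Prop :=
  ∃ U : Set (Cn n), IsOpen U ∧ X ⊆ U ∧ IsContMSubharmonicOn m f U

namespace IsMSubharmonicNear

variable {f g : Cn n → ℝ}

theorem continuousOn (hf : IsMSubharmonicNear m X f) : ContinuousOn f X :=
  let ⟨_, _, hXU, h⟩ := hf
  h.continuousOn.mono hXU

theorem const (hm : 1 ≤ m) (hmn : m ≤ n) (c : ℝ) : IsMSubharmonicNear m X fun _ : Cn n => c :=
  ⟨univ, isOpen_univ, subset_univ _, .const hm hmn isOpen_univ c⟩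

theorem const_mul (hm : 1 ≤ m) (hmn : m ≤ n) (hf : IsMSubharmonicNear m X f) {c : ℝ}
    (hc : 0 ≤ c) : IsMSubharmonicNear m X fun x => c * f x :=
  let ⟨U, hU, hXU, h⟩ := hf
  ⟨U, hU, hXU, h.const_mul hm hmn hc⟩

theorem add (hm : 1 ≤ m) (hmn : m ≤ n) (hf : IsMSubharmonicNear m X f)
    (hg : IsMSubharmonicNear m X g) : IsMSubharmonicNear m X fun x => f x + g x :=
  let ⟨U, hU, hXU, h⟩ := hf
  let ⟨V, hV, hXV, h'⟩ := hg
  ⟨U ∩ V, hU.inter hV, subset_inter hXU hXV,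
    (h.mono inter_subset_left).add hm hmn (hU.inter hV) (h'.mono inter_subset_right)⟩

theorem max (hm : 1 ≤ m) (hmn : m ≤ n) (hf : IsMSubharmonicNear m X f)
    (hg : IsMSubharmonicNear m X g) : IsMSubharmonicNear m X fun x => max (f x) (g x) :=
  let ⟨U, hU, hXU, h⟩ := hf
  let ⟨V, hV, hXV, h'⟩ := hg
  ⟨U ∩ V, hU.inter hV, subset_inter hXU hXV,
    (h.mono inter_subset_left).max hm hmn (hU.inter hV) (h'.mono inter_subset_right)⟩

end IsMSubharmonicNear

/-- The Riesz representation theorem: a positive normalised functional on `C(X)` which dominates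
evaluation at `z` on functions `m`-subharmonic near `X` is given by a Jensen measure. -/
theorem exists_isJensenMeasure_of_linearMap (hX : IsCompact X) {z : Cn n} (l : C(X, ℝ) →ₗ[ℝ] ℝ)
    (hpos : ∀ g : C(X, ℝ), 0 ≤ g → 0 ≤ l g) (hone : l 1 = 1)
    (hJ : ∀ (f : Cn n → ℝ) (hf : IsMSubharmonicNear m X f),
      f z ≤ l ⟨X.domRestrict f, hf.continuousOn.domRestrict⟩) :
    ∃ μ : Measure (Cn n), IsJensenMeasure m X z μ ∧
      ∀ (f : Cn n → ℝ) (hf : ContinuousOn f X), ∫ x in X, f x ∂μ = l ⟨X.domRestrict f, hf.domRestrict⟩ := by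
  have : CompactSpace X := isCompact_iff_compactSpace.1 hX
  let L : CompactlySupportedContinuousMap X ℝ →ₗ[ℝ] ℝ :=
    { toFun := fun f => l f.toContinuousMap
      map_add' := fun f g => l.map_add f.toContinuousMap g.toContinuousMap
      map_smul' := fun c f => l.map_smul c f.toContinuousMap }
  let Λ : CompactlySupportedContinuousMap X ℝ →ₚ[ℝ] ℝ :=
    PositiveLinearMap.mk₀ L fun f hf => hpos f.toContinuousMap hf
  set ν : Measure X := RealRMK.rieszMeasure Λ
  have hν : ∀ g : C(X, ℝ), ∫ x, g x ∂ν = l g := fun g =>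
    RealRMK.integral_rieszMeasure Λ (CompactlySupportedContinuousMap.continuousMapEquiv g)
  have hXm : MeasurableSet X := hX.measurableSet
  have hemb : MeasurableEmbedding (Subtype.val : X → Cn n) := MeasurableEmbedding.subtype_coe hXm
  set μ : Measure (Cn n) := ν.map Subtype.val
  have hfin : IsFiniteMeasure ν := inferInstance
  have hprob : IsProbabilityMeasure ν := by
    have h1 := hν 1
    rw [hone] at h1
    simp only [ContinuousMap.one_apply, integral_const, smul_eq_mul, mul_one] at h1
    exact ⟨by rwa [measureReal_def, ENNReal.toReal_eq_one_iff] at h1⟩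
  have hcar : μ Xᶜ = 0 := by
    rw [hemb.map_apply]
    simp
  have hint : ∀ (f : Cn n → ℝ) (hf : ContinuousOn f X),
      ∫ x in X, f x ∂μ = l ⟨X.domRestrict f, hf.domRestrict⟩ := by
    intro f hf
    rw [Measure.restrict_eq_self_of_ae_mem (mem_ae_iff.2 hcar), hemb.integral_map, ← hν]
    rfl
  refine ⟨μ, ⟨Measure.isProbabilityMeasure_map measurable_subtype_coe.aemeasurable, hcar, ?_⟩, hint⟩
  intro U f hU hXU hf
  rw [hint f (hf.continuousOn.mono hXU)]
  exact hJ f ⟨U, hU, hXU, hf⟩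

/-- The Hahn–Banach part of Edwards' theorem. -/
theorem exists_isMSubharmonicNear_le_of_mem (hm : 1 ≤ m) (hmn : m ≤ n) (hX : IsCompact X)
    {w : Cn n → ℝ} (hw : ContinuousOn w X) {z : Cn n} (hz : z ∈ X)
    (hJ : ∀ μ : Measure (Cn n), IsJensenMeasure m X z μ → w z ≤ ∫ x in X, w x ∂μ)
    {ε : ℝ} (hε : 0 < ε) :
    ∃ f, IsMSubharmonicNear m X f ∧ (∀ x ∈ X, f x ≤ w x) ∧ w z - ε < f z := by
  have : CompactSpace X := isCompact_iff_compactSpace.1 hX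
  -- `N g` is minus the envelope of `-g` at `z`. The two signs turn the superlinear supremum into a
  -- sublinear infimum.
  let F : C(X, ℝ) → Set ℝ := fun g => {t | ∃ f, IsMSubharmonicNear m X f ∧
    (∀ x : X, f x ≤ -g x) ∧ t = -f z}
  let N : C(X, ℝ) → ℝ := fun g => sInf (F g)
  have hne : ∀ g, (F g).Nonempty := fun g =>
    ⟨_, fun _ => -‖g‖, .const hm hmn _, fun x =>
      neg_le_neg ((le_abs_self _).trans (g.norm_coe_le_norm x)), rfl⟩
  have hbdd : ∀ g, BddBelow (F g) := by
    intro g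
    refine ⟨g ⟨z, hz⟩, ?_⟩
    rintro _ ⟨f, -, hf, rfl⟩
    have := hf ⟨z, hz⟩
    simp only at this
    linarith
  have hle : ∀ (g : C(X, ℝ)) (f : Cn n → ℝ), IsMSubharmonicNear m X f → (∀ x : X, f x ≤ -g x) →
      N g ≤ -f z := fun g f h1 h2 => csInf_le (hbdd g) ⟨f, h1, h2, rfl⟩
  have N_hom_le : ∀ c : ℝ, 0 < c → ∀ g, N (c • g) ≤ c * N g := by
    intro c hc g
    rw [← div_le_iff₀' hc]
    refine le_csInf (hne g) ?_
    rintro _ ⟨f, h1, h2, rfl⟩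
    rw [div_le_iff₀' hc]
    have := hle (c • g) (fun x => c * f x) (h1.const_mul hm hmn hc.le) fun x => by
      simpa using mul_le_mul_of_nonneg_left (h2 x) hc.le
    simpa using this
  have N_hom : ∀ c : ℝ, 0 < c → ∀ g, N (c • g) = c * N g := by
    intro c hc g
    refine le_antisymm (N_hom_le c hc g) ?_
    have := N_hom_le c⁻¹ (inv_pos.2 hc) (c • g)
    rw [smul_smul, inv_mul_cancel₀ hc.ne', one_smul, ← div_eq_inv_mul, le_div_iff₀' hc] at this
    exact this
  have N_add : ∀ g h, N (g + h) ≤ N g + N h := by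
    intro g h
    rw [← sub_le_iff_le_add]
    refine le_csInf (hne g) ?_
    rintro _ ⟨f, h1, h2, rfl⟩
    rw [sub_le_iff_le_add, ← sub_le_iff_le_add']
    refine le_csInf (hne h) ?_
    rintro _ ⟨f', h1', h2', rfl⟩
    have := hle (g + h) (fun x => f x + f' x) (h1.add hm hmn h1') fun x => by
      have h3 := h2 x
      have h4 := h2' x
      rw [ContinuousMap.add_apply]
      linarith
    linarith
  set w' : C(X, ℝ) := ⟨X.domRestrict w, hw.domRestrict⟩
  -- Touching `N` at `-w'` makes `l w'` equal to the envelope of `w` at `z`. Domination by `N` makes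
  -- `l` positive, normalised and at least evaluation at `z` on functions `m`-subharmonic near `X`,
  -- so `l` comes from a Jensen measure.
  obtain ⟨l, hlw, hlN⟩ := exists_linearMap_eq_of_sublinear N N_hom N_add (-w')
  have hlneg : ∀ (g : C(X, ℝ)) (f : Cn n → ℝ), IsMSubharmonicNear m X f → (∀ x : X, f x ≤ g x) →
      f z ≤ l g := by
    intro g f h1 h2
    have h3 := (hlN (-g)).trans (hle (-g) f h1 fun x => by simpa using h2 x)
    rw [map_neg] at h3
    linarith
  have hpos : ∀ g : C(X, ℝ), 0 ≤ g → 0 ≤ l g := fun g hg =>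
    hlneg g (fun _ => 0) (.const hm hmn 0) fun x => hg x
  have hone : l 1 = 1 := by
    have h1 := hlneg 1 (fun _ => 1) (.const hm hmn 1) fun x => le_rfl
    have h2 := hlneg (-1) (fun _ => -1) (.const hm hmn (-1)) fun x => le_rfl
    rw [map_neg] at h2
    linarith
  obtain ⟨μ, hμ, hμint⟩ := exists_isJensenMeasure_of_linearMap hX (z := z) l hpos hone
    fun f hf => hlneg _ f hf fun x => le_rfl
  have h1 := hJ μ hμ
  rw [hμint w hw] at h1
  have h2 : N (-w') < -w z + ε := by
    rw [← hlw, map_neg]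
    linarith
  obtain ⟨_, ⟨f, hf1, hf2, rfl⟩, hf3⟩ := exists_lt_of_csInf_lt (hne _) h2
  exact ⟨f, hf1, fun x hx => (hf2 ⟨x, hx⟩).trans_eq (neg_neg (w x)), by linarith⟩

/-- Continuous `m`-subharmonic functions on a compact set `X` are uniform limits of functions that
are continuous and `m`-subharmonic near `X`. -/
theorem exists_isMSubharmonicNear_approx (hm : 1 ≤ m) (hmn : m ≤ n) (hX : IsCompact X)
    {w : Cn n → ℝ} (hw : ContinuousOn w X)
    (hJ : ∀ z ∈ X, ∀ μ : Measure (Cn n), IsJensenMeasure m X z μ → w z ≤ ∫ x in X, w x ∂μ)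
    {ε : ℝ} (hε : 0 < ε) :
    ∃ f, IsMSubharmonicNear m X f ∧ (∀ x ∈ X, f x ≤ w x) ∧ ∀ x ∈ X, w x - ε < f x := by
  have key : ∃ f, IsMSubharmonicNear m X f ∧ (∀ x ∈ X, f x ≤ w x) ∧
      ∀ x ∈ X, x ∈ X → w x - ε < f x := by
    -- Finitely many local approximants are combined by taking maxima. The condition `x ∈ X` is kept
    -- apart from `x ∈ s` because the sets `s` need not lie in `X`.
    refine hX.induction_on (p := fun s => ∃ f, IsMSubharmonicNear m X f ∧ (∀ x ∈ X, f x ≤ w x) ∧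
      ∀ x ∈ s, x ∈ X → w x - ε < f x) ?_ ?_ ?_ ?_
    · obtain ⟨c, hc⟩ := hX.bddBelow_image hw
      exact ⟨fun _ => c, .const hm hmn c, fun x hx => hc (mem_image_of_mem w hx), by simp⟩
    · rintro s t hst ⟨f, h1, h2, h3⟩
      exact ⟨f, h1, h2, fun x hx => h3 x (hst hx)⟩
    · rintro s t ⟨f, h1, h2, h3⟩ ⟨g, k1, k2, k3⟩
      refine ⟨fun x => max (f x) (g x), h1.max hm hmn k1, fun x hx => max_le (h2 x hx) (k2 x hx),
        fun x hx hxX => ?_⟩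
      rcases hx with hx | hx
      · exact (h3 x hx hxX).trans_le (le_max_left _ _)
      · exact (k3 x hx hxX).trans_le (le_max_right _ _)
    · intro z hz
      obtain ⟨f, h1, h2, h3⟩ := exists_isMSubharmonicNear_le_of_mem hm hmn hX hw hz (hJ z hz) hε
      refine ⟨{x | w x - ε < f x}, ?_, f, h1, h2, fun x hx _ => hx⟩
      exact Tendsto.eventually_lt ((hw z hz).sub_const ε) (h1.continuousOn z hz) h3
  obtain ⟨f, h1, h2, h3⟩ := key
  exact ⟨f, h1, h2, fun x hx => h3 x hx hx⟩

end Edwards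

/-! ### Uniform limits, gluing and the conclusion -/

section main

variable {n m : ℕ} {X : Set (Cn n)}

theorem extIntegral_coe (hX : IsCompact X) {μ : Measure (Cn n)} [IsFiniteMeasure μ]
    {u : Cn n → ℝ} (hu : ContinuousOn u X) :
    extIntegral X μ (fun z => (u z : EReal)) = ((∫ x in X, u x ∂μ : ℝ) : EReal) := by
  have hint : IntegrableOn u X μ := hu.integrableOn_compact hX
  have h1 : ∀ f : Cn n → ℝ, IntegrableOn f X μ → ∫⁻ x in X, ENNReal.ofReal (f x) ∂μ ≠ ⊤ :=
    fun f hf => (lt_of_le_of_lt (lintegral_mono fun x => Real.ofReal_le_enorm _) hf.2).ne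
  rw [extIntegral, integral_eq_lintegral_pos_part_sub_lintegral_neg_part hint, EReal.coe_sub,
    EReal.coe_ennreal_toReal (h1 u hint), EReal.coe_ennreal_toReal (h1 (fun x => -u x) hint.neg)]
  rfl

theorem isMSubharmonicOnCompact_coe_iff (hX : IsCompact X) {u : Cn n → ℝ}
    (hu : ContinuousOn u X) : IsMSubharmonicOnCompact m X (fun z => (u z : EReal)) ↔
      ∀ z ∈ X, ∀ μ : Measure (Cn n), IsJensenMeasure m X z μ → u z ≤ ∫ x in X, u x ∂μ := by
  constructor
  · intro h z hz μ hμ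
    have := hμ.isProbabilityMeasure
    have h1 := h.le_extIntegral z hz μ hμ
    rw [extIntegral_coe hX hu] at h1
    exact_mod_cast h1
  · intro h
    refine ⟨(continuous_coe_real_ereal.comp_continuousOn hu).upperSemicontinuousOn,
      fun z _ => EReal.coe_lt_top _, fun z hz μ hμ => ?_⟩
    have := hμ.isProbabilityMeasure
    rw [extIntegral_coe hX hu]
    exact_mod_cast h z hz μ hμ

/-- Uniform limits of functions `m`-subharmonic near `X` satisfy the Jensen inequalities. -/
theorem le_integral_of_approx (hX : IsCompact X) {φ : Cn n → ℝ} (hφ : ContinuousOn φ X)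
    (h : ∀ ε : ℝ, 0 < ε → ∃ f, IsMSubharmonicNear m X f ∧ ∀ x ∈ X, |f x - φ x| ≤ ε)
    {z : Cn n} (hz : z ∈ X) {μ : Measure (Cn n)} (hμ : IsJensenMeasure m X z μ) :
    φ z ≤ ∫ x in X, φ x ∂μ := by
  have := hμ.isProbabilityMeasure
  refine le_of_forall_pos_le_add fun ε hε => ?_
  obtain ⟨f, hf, hfφ⟩ := h (ε / 2) (by positivity)
  have h1 : f z ≤ ∫ x in X, f x ∂μ :=
    let ⟨U, hU, hXU, hfU⟩ := hf
    hμ.le_integral U f hU hXU hfU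
  have hφi : IntegrableOn φ X μ := hφ.integrableOn_compact hX
  have h2 : ∫ x in X, f x ∂μ ≤ ∫ x in X, (φ x + ε / 2) ∂μ :=
    setIntegral_mono_on (hf.continuousOn.integrableOn_compact hX)
      (hφi.add (integrable_const _)) hX.measurableSet
      fun x hx => by linarith [(abs_le.1 (hfφ x hx)).2]
  have hX1 : μ.real X = 1 := by
    rw [measureReal_def, (prob_compl_eq_zero_iff hX.measurableSet).1 hμ.carried,
      ENNReal.toReal_one]
  rw [integral_add hφi (integrable_const _), setIntegral_const, hX1, one_smul] at h2
  have h3 := (abs_le.1 (hfφ z hz)).1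
  linarith

/-- Gluing of functions `m`-subharmonic near compact sets. -/
theorem isMSubharmonicNear_glue (hm : 1 ≤ m) (hmn : m ≤ n) {ω Y : Set (Cn n)} (hω : IsOpen ω)
    (hωY : closure ω ⊆ Y) {f g : Cn n → ℝ} (hf : IsMSubharmonicNear m (closure ω) f)
    (hg : IsMSubharmonicNear m Y g) (hfg : ∀ x ∈ frontier ω, f x < g x) :
    ∃ h, IsMSubharmonicNear m Y h ∧ (∀ x ∈ ω, h x = max (f x) (g x)) ∧ ∀ x ∉ ω, h x = g x := by
  classical
  obtain ⟨U, hU, hωU, hfU⟩ := hf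
  obtain ⟨V, hV, hYV, hgV⟩ := hg
  set h : Cn n → ℝ := fun x => if x ∈ ω then max (f x) (g x) else g x
  have hin : ∀ x ∈ ω, h x = max (f x) (g x) := fun x hx => if_pos hx
  have hout : ∀ x ∉ ω, h x = g x := fun x hx => if_neg hx
  -- Off `K` the glued function is `g`. The strict boundary inequality puts the closed set `K`
  -- inside `ω`, so `ω` and `V \ K` together cover `Y`.
  set K : Set (Cn n) := {x | x ∈ closure ω ∧ g x ≤ f x}
  have hK : IsClosed K := isClosed_closure.isClosed_le
    (hgV.continuousOn.mono (hωY.trans hYV)) (hfU.continuousOn.mono hωU)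
  have hKω : K ⊆ ω := by
    rintro x ⟨hx, hx'⟩
    by_contra hxω
    exact (hfg x ⟨hx, fun hi => hxω (interior_subset hi)⟩).not_ge hx'
  have h1 : IsContMSubharmonicOn m h ω :=
    ((hfU.mono (subset_closure.trans hωU)).max hm hmn hω
      (hgV.mono (subset_closure.trans (hωY.trans hYV)))).congr hm hmn hω
      fun x hx => (hin x hx).symm
  have h2 : IsContMSubharmonicOn m h (V \ K) := by
    refine (hgV.mono sdiff_subset).congr hm hmn (hV.sdiff hK) fun x hx => ?_
    by_cases hxω : x ∈ ω
    · rw [hin x hxω, max_eq_right]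
      by_contra! hlt
      exact hx.2 ⟨subset_closure hxω, hlt.le⟩
    · exact (hout x hxω).symm
  refine ⟨h, ⟨ω ∪ V \ K, hω.union (hV.sdiff hK), fun x hx => ?_,
    h1.union hm hmn hω (hV.sdiff hK) h2⟩, hin, hout⟩
  by_cases hxω : x ∈ ω
  · exact Or.inl hxω
  · exact Or.inr ⟨hYV hx, fun hxK => hxω (hKω hxK)⟩

end main

theorem mainTheorem12 (n m : ℕ) (hm : 1 ≤ m) (hmn : m ≤ n) (ω Ω : Set (Cn n))
    (hω : IsOpen ω) (hΩ : IsOpen Ω) (hΩb : Bornology.IsBounded Ω)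
    (hωΩ : IsCompact (closure ω) ∧ closure ω ⊆ Ω)
    (u v : Cn n → ℝ)
    (hu : IsMSubharmonicOnCompact m (closure ω) (fun z => (u z : EReal)))
    (huc : ContinuousOn u (closure ω))
    (hv : IsMSubharmonicOnCompact m (closure Ω) (fun z => (v z : EReal)))
    (hvc : ContinuousOn v (closure Ω))
    (huv : ∀ z ∈ frontier ω, u z ≤ v z)
    (φ : Cn n → ℝ)
    (hφ : ∀ z ∈ closure Ω \ ω, φ z = v z)
    (hφω : ∀ z ∈ ω, φ z = max (u z) (v z)) :
    IsMSubharmonicOnCompact m (closure Ω) (fun z => (φ z : EReal)) ∧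
      ContinuousOn φ (closure Ω) := by
  have hΩc : IsCompact (closure Ω) := hΩb.isCompact_closure
  have hsub : closure ω ⊆ closure Ω := hωΩ.2.trans subset_closure
  have hcont : ContinuousOn φ (closure Ω) := by
    have h1 : ContinuousOn φ (closure ω) := by
      refine (huc.sup (hvc.mono hsub)).congr fun x hx => ?_
      by_cases hxω : x ∈ ω
      · exact hφω x hxω
      · rw [hφ x ⟨hsub hx, hxω⟩]
        exact (max_eq_right (huv x ⟨hx, fun hi => hxω (interior_subset hi)⟩)).symm
    have h2 : ContinuousOn φ (closure Ω \ ω) := (hvc.mono sdiff_subset).congr hφ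
    refine (h1.union_of_isClosed h2 isClosed_closure (isClosed_closure.sdiff hω)).mono
      fun x hx => ?_
    by_cases hxω : x ∈ ω
    · exact Or.inl (subset_closure hxω)
    · exact Or.inr ⟨hx, hxω⟩
  refine ⟨(isMSubharmonicOnCompact_coe_iff hΩc hcont).2 fun z hz μ hμ =>
    le_integral_of_approx hΩc hcont (fun ε hε => ?_) hz hμ, hcont⟩
  obtain ⟨f, hf, hfu, huf⟩ := exists_isMSubharmonicNear_approx hm hmn hωΩ.1 huc
    ((isMSubharmonicOnCompact_coe_iff hωΩ.1 huc).1 hu) (ε := ε / 3) (by positivity)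
  obtain ⟨g, hg, hgv, hvg⟩ := exists_isMSubharmonicNear_approx hm hmn hΩc hvc
    ((isMSubharmonicOnCompact_coe_iff hΩc hvc).1 hv) (ε := ε / 3) (by positivity)
  -- On the boundary `f - ε/3 ≤ u - ε/3 ≤ v - ε/3 < g`: the shift by the accuracy of `g` makes the
  -- inequality strict, and `f - ε/3` stays within `2ε/3` of `u`.
  obtain ⟨h, hh, hin, hout⟩ := isMSubharmonicNear_glue hm hmn hω hsub
    (hf.add hm hmn (.const hm hmn (-(ε / 3)))) hg fun x hx => by
      have hx' := frontier_subset_closure hx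
      have h1 := hfu x hx'
      have h2 := huv x hx
      have h3 := hvg x (hsub hx')
      linarith
  refine ⟨h, hh, fun x hx => ?_⟩
  have h3 := hgv x hx
  have h4 := hvg x hx
  by_cases hxω : x ∈ ω
  · have h1 := hfu x (subset_closure hxω)
    have h2 := huf x (subset_closure hxω)
    rw [hin x hxω, hφω x hxω]
    refine (abs_max_sub_max_le_max _ _ _ _).trans (max_le ?_ ?_)
    · rw [abs_le]
      constructor <;> linarith
    · rw [abs_le]
      constructor <;> linarith
  · rw [hout x hxω, hφ x ⟨hx, hxω⟩, abs_le]
    constructor <;> linarith
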